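/- Let $F_2$ be the free group on $a,b$. Define subsets $S_{kab}, S_{kba}\subset F_2$ recursively by $S_{0ab}=S_{0ba}=\emptyset$ and, for $k\ge 1$, $$S_{kab}=S_{(k-1)ab}\cup a^{2^{k-1}}S_{(k-1)ab}\,a^{-2^{k-1}}\cup a^{2^{k-1}}S_{(k-1)b}\,a^{-2^{k-1}},\qquad S_{kba}=S_{(k-1)ba}\cup b^{2^{k-1}}S_{(k-1)ba}\,b^{-2^{k-1}}\cup b^{2^{k-1}}S_{(k-1)a}\,b^{-2^{k-1}},$$ where $S_{ka}=\{a^{2^k}\}\cup S_{kab}$ and $S_{kb}=\{b^{2^k}\}\cup S_{kba}$ for $k\ge 0$. Let $G_k'=\langle a^{2^k},b^{2^k},S_{kab},S_{kba}\rangle$; then $G'_{k+1}\le G'_k$. Let $\Lambda_k$ be the Schreier graph of $(F_2,G_k')$ with respect to $\{a,b\}$, regarded as a topological space: its vertices are the cosets $G_k'g$, and for each vertex $G_k'g$ and each $s\in\{a,b\}$ there is one edge (a copy of $[0,1]$) labelled $s$ from $G_k'g$ to $G_k'gs$. Let $\Lambda_{k+1}\to\Lambda_k$ be the map sending the vertex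 $G_{k+1}'g$ to $G_k'g$ and each edge to the edge with the same label starting at the image of its starting vertex. Let $\Lambda=\varprojlim\Lambda_k$ (the simplified Schreier continuum of the Schori solenoid), and let $\mathrm{id}=(\mathrm{id}_k)\in\Lambda$, where $\mathrm{id}_k$ is the vertex $G_k'$ of $\Lambda_k$. Let $L_{\mathrm{id}}$ be the path component of $\mathrm{id}$ in $\Lambda$, equipped with the leaf topology, which has as a base the path components of open subsets of $\Lambda$ contained in $L_{\mathrm{id}}$ (this is the topology of the length metric on $L_{\mathrm{id}}$ in which every edge has length $1$). **Proposition 3.1.** $L_{\mathrm{id}}$ has exactly four ends. Here ends are defined as follows. Let $K_0\subset K_1\subset\cdots$ be compact subsets of a space $X$ with $K_i\subset\operatorname{int}K_{i+1}$ and $\bigcup_i K_i=X$. Consider chains $U_0\supset U_1\supset\cdots$ with $\bigcap_i U_i=\emptyset$, where $U_i$ is an unbounded (i.e. not contained in a compact set) connected component of $X\setminus K_i$. Two chains $\{U_i\},\{V_i\}$ are equivalent if for every $i$ there is $j>i$ with $U_i\cap V_i\supset U_j\cup V_j$. An end of $X$ is an equivalence class of chains. The assertion is that $L_{\mathrm{id}}$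 has such an exhaustion, and that every such exhaustion gives exactly four ends. -/

import Mathlib

open Set Topology

namespace Schori

/-! ### Ends of a topological space -/

section Ends

variable {X : Type*} [TopologicalSpace X]

/-- `U` is an unbounded connected component of the complement of `C`; unbounded means that `U` is
not contained in any compact subset of the space. -/
def IsUnboundedComponent (C U : Set X) : Prop :=
  (∃ x ∈ Cᶜ, U = connectedComponentIn Cᶜ x) ∧ ∀ Q : Set X, IsCompact Q → ¬ U ⊆ Q

/-- For an exhaustion `K 0 ⊆ K 1 ⊆ ...` by compact sets, the chains `U 0 ⊇ U 1 ⊇ ...` of unbounded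
connected components `U i` of the complements of the `K i`, with empty intersection. -/
structure EndChain (K : CompactExhaustion X) where
  /-- The members of the chain. -/
  carrier : ℕ → Set X
  isUnboundedComponent : ∀ i, IsUnboundedComponent (K i) (carrier i)
  antitone : Antitone carrier
  iInter_eq : ⋂ i, carrier i = ∅

/-- Two chains are equivalent if for every `i` there is `j > i` such that
`U i ∩ V i ⊇ U j ∪ V j`. -/
def EndChain.Equiv {K : CompactExhaustion X} (U V : EndChain K) : Prop :=
  ∀ i, ∃ j > i, U.carrier j ∪ V.carrier j ⊆ U.carrier i ∩ V.carrier i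

/-- Equivalence of chains is an equivalence relation. -/
def EndChain.setoid (K : CompactExhaustion X) : Setoid (EndChain K) where
  r := EndChain.Equiv
  iseqv :=
    { refl := fun U i => ⟨i + 1, i.lt_succ_self, by
        rw [union_self, inter_self]
        exact U.antitone i.le_succ⟩
      symm := fun {U V} h i => by
        obtain ⟨j, hj, h'⟩ := h i
        exact ⟨j, hj, by rwa [union_comm, inter_comm]⟩
      trans := fun {U V W} h₁ h₂ i => by
        obtain ⟨j, hj, hUV⟩ := h₁ i
        obtain ⟨l, hl, hVW⟩ := h₂ j
        obtain ⟨p, hp, hVW'⟩ := h₂ i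
        obtain ⟨q, hq, hUV'⟩ := h₁ p
        have hij : i ≤ j := hj.le
        refine ⟨max l q, lt_of_lt_of_le (hj.trans hl) (le_max_left _ _), ?_⟩
        have hU₁ : U.carrier (max l q) ⊆ U.carrier i :=
          U.antitone ((hj.trans hl).le.trans (le_max_left _ _))
        have hW₁ : W.carrier (max l q) ⊆ W.carrier i :=
          W.antitone ((hj.trans hl).le.trans (le_max_left _ _))
        have hU₂ : U.carrier (max l q) ⊆ W.carrier i := fun x hx =>
          (hVW' (Or.inl (hUV' (Or.inl (U.antitone (le_max_right _ _) hx))).2)).2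
        have hW₂ : W.carrier (max l q) ⊆ U.carrier i := fun x hx =>
          (hUV (Or.inr (hVW (Or.inr (W.antitone (le_max_left _ _) hx))).1)).1
        exact union_subset (subset_inter hU₁ hU₂) (subset_inter hW₂ hW₁) }

/-- The set of ends of a space, computed from the exhaustion `K`. -/
def EndSet (K : CompactExhaustion X) : Type _ :=
  Quotient (EndChain.setoid K)

/-- A space has exactly `n` ends (`n ≥ 1`): it is exhausted by compact sets, and every such
exhaustion gives exactly `n` classes of chains. -/
def HasExactlyEnds (X : Type*) [TopologicalSpace X] (n : ℕ) : Prop :=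
  Nonempty (CompactExhaustion X) ∧
    ∀ K : CompactExhaustion X, Finite (EndSet K) ∧ Nat.card (EndSet K) = n

end Ends

/-! ### Path components with the leaf topology -/

section Leaves

variable {X : Type*} [TopologicalSpace X]

/-- The leaf topology: a base is given by the path components of open sets. -/
@[reducible]
def leafTopology (X : Type*) [TopologicalSpace X] : TopologicalSpace X :=
  TopologicalSpace.generateFrom
    {P | ∃ U : Set X, IsOpen U ∧ ∃ x ∈ U, P = pathComponentIn U x}

/-- The path component of `x`, as a space with the leaf topology (and not with the
subspace topology). -/
def Leaf (x : X) : Type _ :=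
  {y : X // y ∈ pathComponent x}

instance (x : X) : TopologicalSpace (Leaf x) :=
  (leafTopology X).induced Subtype.val

end Leaves

/-! ### Schreier graphs of the free group of rank two -/

/-- The free group on two generators. -/
abbrev F₂ : Type := FreeGroup (Fin 2)

/-- The free generator `a`. -/
def a : F₂ := FreeGroup.of 0

/-- The free generator `b`. -/
def b : F₂ := FreeGroup.of 1

/-- The vertices of the Schreier graph of `(F₂, H)`: the orbits `H g` of the left action of `H`
on the Cayley graph, with the discrete topology. -/
def Vertex (H : Subgroup F₂) : Type :=
  Quotient (QuotientGroup.rightRel H)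

instance (H : Subgroup F₂) : TopologicalSpace (Vertex H) := ⊥

instance (H : Subgroup F₂) : DiscreteTopology (Vertex H) := ⟨rfl⟩

/-- The vertex `H g`. -/
def Vertex.mk (H : Subgroup F₂) (g : F₂) : Vertex H :=
  Quotient.mk (QuotientGroup.rightRel H) g

/-- The end point `H g s` of the edge labelled by the generator `s` that starts at `H g`. -/
def Vertex.step {H : Subgroup F₂} (s : Fin 2) : Vertex H → Vertex H :=
  Quotient.map (fun g : F₂ => g * FreeGroup.of s) (by
    intro g g' h
    change QuotientGroup.rightRel H _ _ at h
    change QuotientGroup.rightRel H _ _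
    rw [QuotientGroup.rightRel_apply] at h ⊢
    simpa [mul_assoc] using h)

/-- The map `H g ↦ K g` for `H ≤ K`. -/
def Vertex.map {H K : Subgroup F₂} (h : H ≤ K) : Vertex H → Vertex K :=
  Quotient.map id (by
    intro g g' hg
    change QuotientGroup.rightRel H _ _ at hg
    change QuotientGroup.rightRel K _ _
    rw [QuotientGroup.rightRel_apply] at hg ⊢
    exact h hg)

/-- The vertices together with one unit interval for each edge, before gluing;
`Sum.inr (v, s, t)` is the point at time `t` on the edge labelled by `s` that starts at `v`. -/
abbrev PreSchreierGraph (H : Subgroup F₂) : Type :=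
  Vertex H ⊕ (Vertex H × Fin 2 × unitInterval)

/-- The gluing of the two end points of each edge to its starting and its ending vertex. -/
inductive Glue (H : Subgroup F₂) : PreSchreierGraph H → PreSchreierGraph H → Prop
  | source (v : Vertex H) (s : Fin 2) : Glue H (Sum.inr (v, s, 0)) (Sum.inl v)
  | target (v : Vertex H) (s : Fin 2) : Glue H (Sum.inr (v, s, 1)) (Sum.inl (v.step s))

/-- The Schreier graph of `(F₂, H)` with respect to the generators `a`, `b`, as a topological
space (a one-dimensional cell complex, with the quotient topology). -/
def SchreierGraph (H : Subgroup F₂) : Type :=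
  Quot (Glue H)

instance (H : Subgroup F₂) : TopologicalSpace (SchreierGraph H) :=
  inferInstanceAs (TopologicalSpace (Quot (Glue H)))

/-- The point of the Schreier graph given by a vertex. -/
def SchreierGraph.vertex {H : Subgroup F₂} (v : Vertex H) : SchreierGraph H :=
  Quot.mk _ (Sum.inl v)

/-- The map of Schreier graphs induced by `H ≤ K`: it sends `H g` to `K g`, and each edge to the
edge with the same label that starts at the image of its starting vertex. -/
def SchreierGraph.map {H K : Subgroup F₂} (h : H ≤ K) : SchreierGraph H → SchreierGraph K :=
  Quot.map (Sum.map (Vertex.map h) (Prod.map (Vertex.map h) id)) (by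
    rintro _ _ (⟨v, s⟩ | ⟨v, s⟩)
    · exact Glue.source _ s
    · have hv : Vertex.map h (v.step s) = (Vertex.map h v).step s := by
        obtain ⟨g, rfl⟩ := Quotient.exists_rep v
        rfl
      simp only [Sum.map_inl, Sum.map_inr, hv]
      exact Glue.target _ s)

/-! ### The group chain and the Schreier continuum -/

/-- The sets `S_{kab}` (for `x = a`, `y = b`) and `S_{kba}` (for `x = b`, `y = a`):
`S_{0xy} = ∅` and `S_{(k+1)xy}` is the union of `S_{kxy}`, `x^{2^k} S_{kxy} x^{-2^k}` and
`x^{2^k} S_{ky} x^{-2^k}`, where `S_{ky} = {y^{2^k}} ∪ S_{kyx}`. -/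
def crossGens : ℕ → F₂ → F₂ → Set F₂
  | 0, _, _ => ∅
  | k + 1, x, y =>
      crossGens k x y ∪
      (fun g => x ^ 2 ^ k * g * (x ^ 2 ^ k)⁻¹) '' crossGens k x y ∪
      (fun g => x ^ 2 ^ k * g * (x ^ 2 ^ k)⁻¹) '' ({y ^ 2 ^ k} ∪ crossGens k y x)

/-- The subgroup `G_k'`, generated by `a^{2^k}`, `b^{2^k}`, `S_{kab}` and `S_{kba}`. -/
def G (k : ℕ) : Subgroup F₂ :=
  Subgroup.closure ({a ^ 2 ^ k, b ^ 2 ^ k} ∪ crossGens k a b ∪ crossGens k b a)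

theorem crossGens_succ_subset {k : ℕ} {x y : F₂} {N : Subgroup F₂} (hx : x ^ 2 ^ k ∈ N)
    (hy : y ^ 2 ^ k ∈ N) (hxy : crossGens k x y ⊆ N) (hyx : crossGens k y x ⊆ N) :
    crossGens (k + 1) x y ⊆ N := by
  have conj_mem : ∀ g ∈ N, x ^ 2 ^ k * g * (x ^ 2 ^ k)⁻¹ ∈ N := fun g hg =>
    N.mul_mem (N.mul_mem hx hg) (N.inv_mem hx)
  rintro _ ((h | ⟨g, hg, rfl⟩) | ⟨g, (rfl | hg), rfl⟩)
  · exact hxy h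
  · exact conj_mem g (hxy hg)
  · exact conj_mem _ hy
  · exact conj_mem g (hyx hg)

/-- The chain of subgroups is decreasing. -/
theorem G_succ_le (k : ℕ) : G (k + 1) ≤ G k := by
  have ha : a ^ 2 ^ k ∈ G k := Subgroup.subset_closure (Or.inl (Or.inl (Or.inl rfl)))
  have hb : b ^ 2 ^ k ∈ G k := Subgroup.subset_closure (Or.inl (Or.inl (Or.inr rfl)))
  have hab : crossGens k a b ⊆ G k := fun _ h => Subgroup.subset_closure (Or.inl (Or.inr h))
  have hba : crossGens k b a ⊆ G k := fun _ h => Subgroup.subset_closure (Or.inr h)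
  refine (Subgroup.closure_le _).2 ?_
  rintro g (((rfl | rfl) | h) | h)
  · rw [pow_succ, pow_mul]
    exact (G k).pow_mem ha 2
  · rw [pow_succ, pow_mul]
    exact (G k).pow_mem hb 2
  · exact crossGens_succ_subset ha hb hab hba h
  · exact crossGens_succ_subset hb ha hba hab h

/-- The graph `Λ_k`, the Schreier graph of `(F₂, G_k')`. -/
abbrev LambdaGraph (k : ℕ) : Type := SchreierGraph (G k)

/-- The bonding map `Λ_{k+1} → Λ_k`. -/
def bonding (k : ℕ) : LambdaGraph (k + 1) → LambdaGraph k :=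
  SchreierGraph.map (G_succ_le k)

/-- The simplified Schreier continuum `Λ` of the Schori solenoid: the inverse limit of the graphs
`Λ_k`, with the topology of a subspace of their product. -/
def Continuum : Type :=
  {x : (k : ℕ) → LambdaGraph k // ∀ k, bonding k (x (k + 1)) = x k}

instance : TopologicalSpace Continuum :=
  inferInstanceAs
    (TopologicalSpace {x : (k : ℕ) → LambdaGraph k // ∀ k, bonding k (x (k + 1)) = x k})

/-- The point `id = (id_k)` of `Λ`, where `id_k` is the coset of the identity. -/
def idPoint : Continuum :=
  ⟨fun k => SchreierGraph.vertex (Vertex.mk (G k) 1), fun _ => rfl⟩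

end Schori

/-!
The vertices of `Λ_k` are named by the words of length `k` in three letters `none`, `some 0`,
`some 1`, in such a way that the generator `s` acts as an odometer: it adds `1` with carry, with
`none` as the digit `0` and `some s` as the digit `1`, and the third letter absorbs the carry
(`Seq.step`). That `G k` fixes the word of letters `none` is a computation on its generators
(`Seq.zero_act_of_mem_G`). Conversely, with suitable coset representatives all Schreier generators
of the stabilizer lie in `G k` (`schreier_mem_G`). So the coherent sequences of vertices are the
infinite sequences of letters (`Seq.vertex_injective`, `Seq.exists_vertex_eq`), and every point of
`Λ` lies on an edge that starts at such a sequence (`exists_edgePoint_eq`).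

Open stars of vertices are open in the leaf topology, because a path that stays near the vertices
stays near one vertex of each `Λ_k` (`isOpen_leafTopology_of_clopen`). It follows that the leaf of
the identity is the graph spanned by the orbit of the constant sequence `none`, which consists of
the eventually constant sequences (`pathComponent_idPoint`).

Among these, the sequences that are not yet constant from the index `n` on fall into four arms: for
each generator `s`, those that are eventually `some s`, and those that are eventually `none` with
`some s` as the last other letter. No edge joins two arms (`arm_eq_of_step`), each arm is connected
(`stepConnected_arm`), and the part of the leaf outside the arms is covered by finitely many edges.
A space with such a system of arms has as many ends as arms (`hasExactlyEnds_of_arms`).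
-/

namespace Schori

/-! ### Counting ends by arms -/

section Ends

variable {X : Type*} [TopologicalSpace X]

theorem exists_subset_of_isCompact {C : ℕ → Set X} (hC : Monotone C) (hnhds : ∀ x, ∃ n, C n ∈ 𝓝 x)
    {Q : Set X} (hQ : IsCompact Q) : ∃ n, Q ⊆ C n := by
  refine hQ.induction_on (p := fun s => ∃ n, s ⊆ C n) ⟨0, empty_subset _⟩ ?_ ?_ ?_
  · rintro s t hst ⟨n, hn⟩
    exact ⟨n, hst.trans hn⟩
  · rintro s t ⟨n, hn⟩ ⟨m, hm⟩
    exact ⟨max n m, union_subset (hn.trans (hC (le_max_left _ _)))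
      (hm.trans (hC (le_max_right _ _)))⟩
  · intro x _
    obtain ⟨n, hn⟩ := hnhds x
    exact ⟨C n, mem_nhdsWithin_of_mem_nhds hn, n, subset_rfl⟩

theorem nonempty_compactExhaustion {C : ℕ → Set X} (hC : ∀ n, IsCompact (C n))
    (hnhds : ∀ x, ∃ n, C n ∈ 𝓝 x) : Nonempty (CompactExhaustion X) := by
  have : WeaklyLocallyCompactSpace X :=
    ⟨fun x => let ⟨n, hn⟩ := hnhds x; ⟨C n, hC n, hn⟩⟩
  have : SigmaCompactSpace X :=
    ⟨C, hC, iUnion_eq_univ_iff.2 fun x => let ⟨n, hn⟩ := hnhds x; ⟨n, mem_of_mem_nhds hn⟩⟩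
  exact ⟨CompactExhaustion.choice X⟩

/-- If the complements of a growing sequence of compact sets split into open connected arms,
indexed by `ι` and nested, then the ends of the space are in bijection with the arms. -/
theorem hasExactlyEnds_of_arms {ι : Type*} [Finite ι] (U : ℕ → ι → Set X)
    (hopen : ∀ n j, IsOpen (U n j)) (hconn : ∀ n j, IsConnected (U n j))
    (hdisj : ∀ n j j', j ≠ j' → Disjoint (U n j) (U n j'))
    (hanti : ∀ j, Antitone fun n => U n j)
    (hcpt : ∀ n, IsCompact (⋃ j, U n j)ᶜ) (hnhds : ∀ x, ∃ n, (⋃ j, U n j)ᶜ ∈ 𝓝 x) :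
    HasExactlyEnds X (Nat.card ι) := by
  have hmono : Monotone fun n => (⋃ j, U n j)ᶜ := fun m n hmn =>
    compl_subset_compl.2 (iUnion_mono fun j => hanti j hmn)
  have hsub : ∀ Q : Set X, IsCompact Q → ∃ n, Q ⊆ (⋃ j, U n j)ᶜ := fun Q hQ =>
    exists_subset_of_isCompact hmono hnhds hQ
  refine ⟨nonempty_compactExhaustion hcpt hnhds, fun K => ?_⟩
  -- `n i` is an index beyond which the arms avoid `K i`.
  choose n hn using fun i => hsub (K i) (K.isCompact i)
  have hUK : ∀ {i m} j, n i ≤ m → U m j ⊆ (K i)ᶜ := fun {i m} j hm x hx hxK =>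
    hn i hxK (mem_iUnion_of_mem j (hanti j hm hx))
  have hunb : ∀ m j Q, IsCompact Q → ¬ U m j ⊆ Q := by
    intro m j Q hQ h
    obtain ⟨l, hl⟩ := hsub Q hQ
    obtain ⟨x, hx⟩ := (hconn (max m l) j).nonempty
    exact hl (h (hanti j (le_max_left _ _) hx))
      (mem_iUnion_of_mem j (hanti j (le_max_right _ _) hx))
  choose x hx using fun i j => (hconn (n i) j).nonempty
  -- `W j i` is the component of the complement of `K i` that contains the far part of arm `j`.
  let W : ι → ℕ → Set X := fun j i => connectedComponentIn (K i)ᶜ (x i j)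
  have hUW : ∀ {i m} j, n i ≤ m → U m j ⊆ W j i := fun {i m} j hm =>
    (hanti j hm).trans
      ((hconn (n i) j).isPreconnected.subset_connectedComponentIn (hx i j) (hUK j le_rfl))
  have hWeq : ∀ {i} j y, y ∈ W j i → W j i = connectedComponentIn (K i)ᶜ y := fun j y hy =>
    connectedComponentIn_eq hy
  have hWanti : ∀ j, Antitone (W j) := by
    intro j i i' hii'
    set m := max (n i) (n i')
    obtain ⟨y, hy⟩ := (hconn m j).nonempty
    have h1 : y ∈ W j i := hUW j (le_max_left _ _) hy
    have h2 : y ∈ W j i' := hUW j (le_max_right _ _) hy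
    rw [hWeq j y h1, hWeq j y h2]
    exact connectedComponentIn_mono _ (compl_subset_compl.2 (K.subset hii'))
  have hempty : ∀ V : ℕ → Set X, (∀ i, V i ⊆ (K i)ᶜ) → ⋂ i, V i = ∅ := by
    intro V hV
    refine eq_empty_of_forall_notMem fun y hy => ?_
    obtain ⟨i, hi⟩ := mem_iUnion.1 (K.iUnion_eq.symm ▸ mem_univ y : y ∈ ⋃ i, K i)
    exact hV i (mem_iInter.1 hy i) hi
  let E : ι → EndChain K := fun j =>
    { carrier := W j
      isUnboundedComponent := fun i => ⟨⟨x i j, hUK j le_rfl (hx i j), rfl⟩, fun Q hQ h =>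
        hunb (n i) j Q hQ ((hUW j le_rfl).trans h)⟩
      antitone := hWanti j
      iInter_eq := hempty _ fun i => connectedComponentIn_subset _ _ }
  have hinj : Function.Injective fun j => (Quotient.mk (EndChain.setoid K) (E j) : EndSet K) := by
    intro j j' h
    by_contra hne
    have h : EndChain.Equiv (E j) (E j') := Quotient.exact h
    obtain ⟨i, hi⟩ := exists_subset_of_isCompact (C := K) (fun _ _ h => K.subset h)
      (fun x => by
        obtain ⟨i, hi⟩ := K.exists_mem_nhds x
        exact ⟨i, hi⟩) (hcpt 0)
    have hW : ∀ j, W j i ⊆ U 0 j := by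
      intro j
      refine IsPreconnected.subset_left_of_subset_union (hopen 0 j)
        (isOpen_iUnion fun j' => isOpen_iUnion fun _ : j' ≠ j => hopen 0 j') ?_ ?_
        ⟨x i j, hUW j le_rfl (hx i j), hanti j (Nat.zero_le _) (hx i j)⟩
        isPreconnected_connectedComponentIn
      · simp only [disjoint_iUnion_right]
        exact fun j' hj' => hdisj 0 _ _ hj'.symm
      · intro y hy
        have hy : y ∉ (⋃ j, U 0 j)ᶜ := fun h => connectedComponentIn_subset _ _ hy (hi h)
        obtain ⟨j', hj'⟩ := mem_iUnion.1 (notMem_compl_iff.1 hy)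
        by_cases hjj : j' = j
        · exact Or.inl (hjj ▸ hj')
        · exact Or.inr (mem_iUnion₂.2 ⟨j', hjj, hj'⟩)
    obtain ⟨l, -, hl⟩ := h i
    have h1 := hl (Or.inl (hUW j le_rfl (hx l j)))
    exact disjoint_left.1 (hdisj 0 j j' hne) (hW j h1.1) (hW j' h1.2)
  have hsurj : Function.Surjective
      fun j => (Quotient.mk (EndChain.setoid K) (E j) : EndSet K) := by
    intro q
    obtain ⟨V, rfl⟩ := Quotient.exists_rep q
    -- Each member of the chain contains the far part of some arm; by the pigeonhole principle
    -- one arm serves infinitely many of them.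
    have hV : ∀ i, ∃ j, V.carrier i = W j i := by
      intro i
      obtain ⟨⟨y, hy, hVy⟩, hVu⟩ := V.isUnboundedComponent i
      obtain ⟨z, hzV, hz⟩ := not_subset.1 (hVu _ (hcpt (n i)))
      obtain ⟨j, hj⟩ := mem_iUnion.1 (notMem_compl_iff.1 hz)
      refine ⟨j, ?_⟩
      rw [hWeq j z (hUW j le_rfl hj), hVy]
      exact connectedComponentIn_eq (hVy ▸ hzV)
    choose f hf using hV
    obtain ⟨j, hj⟩ := Finite.exists_infinite_fiber f
    have hj : (f ⁻¹' {j}).Infinite := infinite_coe_iff.1 hj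
    have hVW : ∀ i, V.carrier i = W j i := by
      intro i
      obtain ⟨i', hi', hii'⟩ := hj.exists_gt i
      have h1 : x i' j ∈ W j i' := hUW j le_rfl (hx i' j)
      have h2 : x i' j ∈ V.carrier i := V.antitone hii'.le (by rw [hf i', hi']; exact h1)
      have h3 : x i' j ∈ W j i := hWanti j hii'.le h1
      rw [hWeq j _ h3]
      rw [hf i] at h2 ⊢
      exact hWeq _ _ h2
    refine ⟨j, Quotient.sound fun i => ⟨i + 1, i.lt_succ_self, ?_⟩⟩
    have : V.carrier = (E j).carrier := funext hVW
    rw [this, union_self, inter_self]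
    exact hWanti j i.le_succ
  have e := Equiv.ofBijective _ ⟨hinj, hsurj⟩
  exact ⟨Finite.of_equiv _ e, (Nat.card_congr e).symm⟩

end Ends

/-! ### The leaf topology -/

section Leaves

variable {X Y : Type*} [TopologicalSpace X] [TopologicalSpace Y]

/-- A continuous map from a locally path connected space remains continuous when its target gets
the leaf topology. -/
theorem continuous_leafTopology [LocallyPathConnectedSpace Y] {f : Y → X} (hf : Continuous f) :
    @Continuous Y X _ (leafTopology X) f := by
  refine continuous_generateFrom_iff.2 ?_
  rintro _ ⟨U, hU, x, hx, rfl⟩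
  refine isOpen_iff_mem_nhds.2 fun y hy => ?_
  have hyU : f y ∈ U := pathComponentIn_subset (mem_preimage.1 hy)
  have hmem : pathComponentIn (f ⁻¹' U) y ∈ 𝓝 y :=
    pathComponentIn_mem_nhds ((hU.preimage hf).mem_nhds hyU)
  filter_upwards [hmem] with z hz
  have h : JoinedIn U (f y) (f z) := by
    obtain ⟨γ, hγ⟩ := hz
    exact ⟨γ.map hf, hγ⟩
  exact JoinedIn.trans (mem_preimage.1 hy) h

/-- A subset of an open set `O` that is cut out by subsets clopen in `O` is open in the leaf
topology, since a path in `O` cannot leave it. -/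
theorem isOpen_leafTopology_of_clopen {κ : Type*} {O : Set X} {Z Z' : κ → Set X} (hO : IsOpen O)
    (hZ : ∀ k, IsOpen (Z k)) (hZ' : ∀ k, IsOpen (Z' k)) (hd : ∀ k, Disjoint (Z k) (Z' k))
    (hc : ∀ k, O ⊆ Z k ∪ Z' k) : IsOpen[leafTopology X] (O ∩ ⋂ k, Z k) := by
  refine (@isOpen_iff_forall_mem_open X (leafTopology X) _).2 fun x hx => ?_
  refine ⟨pathComponentIn O x, fun y hy => ?_,
    TopologicalSpace.isOpen_generateFrom_of_mem ⟨O, hO, x, hx.1, rfl⟩,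
    mem_pathComponentIn_self hx.1⟩
  refine ⟨pathComponentIn_subset hy, mem_iInter.2 fun k => ?_⟩
  exact IsPreconnected.subset_left_of_subset_union (hZ k) (hZ' k) (hd k)
    (pathComponentIn_subset.trans (hc k)) ⟨x, mem_pathComponentIn_self hx.1, mem_iInter.1 hx.2 k⟩
    (isPathConnected_pathComponentIn hx.1).isConnected.isPreconnected hy

end Leaves

/-! ### The odometers on sequences of three letters -/

/-- Sequences in three letters: the letter `none` is the neutral one, and `some s` belongs to the
generator `s`. -/
abbrev Seq : Type := ℕ → Option (Fin 2)

/-- The odometer of the generator `s`: it adds `1` with carry, with `none` as the digit `0` and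
`some s` as the digit `1`; the third letter absorbs the carry. -/
def Seq.step (s : Fin 2) (x : Seq) : Seq := fun i =>
  if ∀ j < i, x j = some s then Equiv.swap none (some s) (x i) else x i

/-- The inverse of the odometer of `s`. -/
def Seq.stepInv (s : Fin 2) (x : Seq) : Seq := fun i =>
  if ∀ j < i, x j = none then Equiv.swap none (some s) (x i) else x i

theorem Seq.step_apply (s : Fin 2) (x : Seq) (i : ℕ) : x.step s i =
    if ∀ j < i, x j = some s then Equiv.swap none (some s) (x i) else x i := rfl

theorem Seq.stepInv_apply (s : Fin 2) (x : Seq) (i : ℕ) : x.stepInv s i =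
    if ∀ j < i, x j = none then Equiv.swap none (some s) (x i) else x i := rfl

theorem Seq.carry_step (s : Fin 2) (x : Seq) (i : ℕ) :
    (∀ j < i, x.step s j = none) ↔ ∀ j < i, x j = some s := by
  constructor
  · intro h j
    induction j using Nat.strong_induction_on with
    | _ j ih =>
      intro hj
      have := h j hj
      rw [Seq.step_apply, if_pos fun l hl => ih l hl (hl.trans hj)] at this
      rwa [Equiv.swap_apply_eq_iff, Equiv.swap_apply_left] at this
  · intro h j hj
    rw [Seq.step_apply, if_pos fun l hl => h l (hl.trans hj), h j hj, Equiv.swap_apply_right]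

theorem Seq.carry_stepInv (s : Fin 2) (x : Seq) (i : ℕ) :
    (∀ j < i, x.stepInv s j = some s) ↔ ∀ j < i, x j = none := by
  constructor
  · intro h j
    induction j using Nat.strong_induction_on with
    | _ j ih =>
      intro hj
      have := h j hj
      rw [Seq.stepInv_apply, if_pos fun l hl => ih l hl (hl.trans hj)] at this
      rwa [Equiv.swap_apply_eq_iff, Equiv.swap_apply_right] at this
  · intro h j hj
    rw [Seq.stepInv_apply, if_pos fun l hl => h l (hl.trans hj), h j hj, Equiv.swap_apply_left]

/-- The odometer of `s` as a permutation. -/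
def Seq.stepEquiv (s : Fin 2) : Equiv.Perm Seq where
  toFun := Seq.step s
  invFun := Seq.stepInv s
  left_inv x := by
    funext i
    rw [Seq.stepInv_apply, Seq.step_apply]
    simp only [Seq.carry_step]
    split_ifs <;> simp
  right_inv x := by
    funext i
    rw [Seq.step_apply, Seq.stepInv_apply]
    simp only [Seq.carry_stepInv]
    split_ifs <;> simp

/-- The right action of the free group on sequences in which the generators act as odometers. -/
def Seq.act (x : Seq) (g : F₂) : Seq :=
  (FreeGroup.lift (fun s => MulOpposite.op (Seq.stepEquiv s)) g).unop x

@[simp] theorem Seq.act_one (x : Seq) : x.act 1 = x := by simp [Seq.act]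

theorem Seq.act_mul (x : Seq) (g h : F₂) : x.act (g * h) = (x.act g).act h := by simp [Seq.act]

@[simp] theorem Seq.act_of (x : Seq) (s : Fin 2) : x.act (FreeGroup.of s) = x.step s := by
  simp only [Seq.act, FreeGroup.lift_apply_of]; rfl

theorem Seq.act_inv_of (x : Seq) (s : Fin 2) : x.act (FreeGroup.of s)⁻¹ = x.stepInv s := by
  simp only [Seq.act, map_inv, FreeGroup.lift_apply_of]; rfl

theorem Seq.act_inv_eq {x y : Seq} {g : F₂} (h : x.act g = y) : y.act g⁻¹ = x := by
  rw [← h, ← Seq.act_mul, mul_inv_cancel, Seq.act_one]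

/-- The first `k` letters of the image depend only on the first `k` letters. -/
theorem Seq.act_congr {k : ℕ} (g : F₂) : ∀ {x y : Seq}, (∀ i < k, x i = y i) →
    ∀ i < k, x.act g i = y.act g i := by
  induction g using FreeGroup.induction_on with
  | C1 => simp
  | of s =>
    intro x y h i hi
    have : (∀ j < i, x j = some s) ↔ ∀ j < i, y j = some s :=
      forall₂_congr fun j hj => by rw [h j (hj.trans hi)]
    simp only [Seq.act_of, Seq.step_apply, this, h i hi]
  | inv_of s _ =>
    intro x y h i hi
    have : (∀ j < i, x j = none) ↔ ∀ j < i, y j = none :=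
      forall₂_congr fun j hj => by rw [h j (hj.trans hi)]
    simp only [Seq.act_inv_of, Seq.stepInv_apply, this, h i hi]
  | mul g h hg hh =>
    intro x y hxy
    simp only [Seq.act_mul]
    exact hh (hg hxy)

/-- The sequence with first letter `c` and tail `x`. -/
def Seq.cons (c : Option (Fin 2)) (x : Seq) : Seq
  | 0 => c
  | i + 1 => x i

/-- The sequence of `k` letters `none`, followed by `x`. -/
def Seq.pad : ℕ → Seq → Seq
  | 0, x => x
  | k + 1, x => Seq.pad k (Seq.cons none x)

/-- The constant sequence `none`. -/
def Seq.zero : Seq := fun _ => none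

theorem Seq.cons_zero : Seq.cons none Seq.zero = Seq.zero := by
  funext i; cases i <;> rfl

theorem Seq.pad_zero (k : ℕ) : Seq.pad k Seq.zero = Seq.zero := by
  induction k with
  | zero => rfl
  | succ k ih => rw [Seq.pad, Seq.cons_zero, ih]

theorem Seq.pad_apply (k i : ℕ) (x : Seq) :
    Seq.pad k x i = if i < k then none else x (i - k) := by
  induction k generalizing x with
  | zero => simp [Seq.pad]
  | succ k ih =>
    rw [Seq.pad, ih]
    rcases lt_trichotomy i k with h | rfl | h
    · simp [h, h.trans k.lt_succ_self]
    · simp [Seq.cons]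
    · obtain ⟨d, rfl⟩ := Nat.exists_eq_add_of_lt h
      rw [if_neg (by omega), if_neg (by omega), show k + d + 1 - k = d + 1 by omega,
        show k + d + 1 - (k + 1) = d by omega]
      rfl

theorem Seq.forall_lt_cons {c : Option (Fin 2)} {x : Seq} {p : Option (Fin 2) → Prop} {i : ℕ} :
    (∀ j < i + 1, p (Seq.cons c x j)) ↔ p c ∧ ∀ j < i, p (x j) := by
  constructor
  · exact fun h => ⟨h 0 (Nat.succ_pos _), fun j hj => h (j + 1) (Nat.succ_lt_succ hj)⟩
  · rintro ⟨h0, h⟩ (_ | j) hj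
    · exact h0
    · exact h j (Nat.lt_of_succ_lt_succ hj)

theorem Seq.step_cons_none (s : Fin 2) (x : Seq) :
    (Seq.cons none x).step s = Seq.cons (some s) x := by
  funext i
  cases i with
  | zero => simp [Seq.step_apply, Seq.cons]
  | succ i =>
    rw [Seq.step_apply, if_neg]
    · rfl
    · exact fun h => by simpa [Seq.cons] using h 0 (Nat.succ_pos _)

theorem Seq.step_cons_self (s : Fin 2) (x : Seq) :
    (Seq.cons (some s) x).step s = Seq.cons none (x.step s) := by
  funext i
  cases i with
  | zero => simp [Seq.step_apply, Seq.cons]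
  | succ i =>
    have h := Seq.forall_lt_cons (c := some s) (x := x) (p := fun c => c = some s) (i := i)
    simp only [true_and] at h
    simp only [Seq.step_apply, h]
    rfl

theorem Seq.step_cons_of_ne {s r : Fin 2} (h : r ≠ s) (x : Seq) :
    (Seq.cons (some r) x).step s = Seq.cons (some r) x := by
  funext i
  cases i with
  | zero =>
    simp only [Seq.step_apply, Seq.cons, Nat.not_lt_zero, false_imp_iff, implies_true, if_true]
    exact Equiv.swap_apply_of_ne_of_ne (by simp) (by simpa using h)
  | succ i =>
    rw [Seq.step_apply, if_neg]
    exact fun h' => h (by simpa [Seq.cons] using h' 0 (Nat.succ_pos _))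

/-- The `2 ^ k`-th power of an odometer acts behind a block of `k` letters `none` as the
odometer itself. -/
theorem Seq.act_pow_pad (s : Fin 2) (k : ℕ) (x : Seq) :
    (Seq.pad k x).act (FreeGroup.of s ^ 2 ^ k) = Seq.pad k (x.step s) := by
  induction k generalizing x with
  | zero => simp [Seq.pad]
  | succ k ih =>
    rw [pow_succ, pow_mul, pow_two, Seq.act_mul, Seq.pad, ih, ih, Seq.step_cons_none,
      Seq.step_cons_self]
    rfl

/-- The conjugated generators of `G k` do not carry out of the first `k` letters: they fix a block
of `k` letters `none` whatever follows it. -/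
theorem Seq.act_crossGens {k : ℕ} {s r : Fin 2} (hsr : s ≠ r) {g : F₂}
    (hg : g ∈ crossGens k (FreeGroup.of s) (FreeGroup.of r)) (x : Seq) :
    (Seq.pad k x).act g = Seq.pad k x := by
  induction k generalizing s r g x with
  | zero => exact hg.elim
  | succ k ih =>
    -- Conjugating by the `2 ^ k`-th power moves the letter behind the block to `some s`.
    have key : ∀ g, (Seq.pad k (Seq.cons (some s) x)).act g = Seq.pad k (Seq.cons (some s) x) →
        (Seq.pad (k + 1) x).act
          (FreeGroup.of s ^ 2 ^ k * g * (FreeGroup.of s ^ 2 ^ k)⁻¹) = Seq.pad (k + 1) x := by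
      intro g hg
      have h1 := Seq.act_pow_pad s k (Seq.cons none x)
      rw [Seq.step_cons_none] at h1
      rw [Seq.act_mul, Seq.act_mul, Seq.pad, h1, hg]
      exact Seq.act_inv_eq h1
    rcases hg with (h | ⟨g, h, rfl⟩) | ⟨g, (rfl | h), rfl⟩
    · exact ih hsr h _
    · exact key _ (ih hsr h _)
    · exact key _ (by rw [Seq.act_pow_pad, Seq.step_cons_of_ne hsr])
    · exact key _ (ih hsr.symm h _)

/-- The subgroup `G k` preserves the first `k` letters of the sequence `zero`. -/
theorem Seq.zero_act_of_mem_G {k : ℕ} {g : F₂} (hg : g ∈ G k) :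
    ∀ i < k, Seq.zero.act g i = none := by
  have hpow : ∀ s, ∀ i < k, Seq.zero.act (FreeGroup.of s ^ 2 ^ k) i = none := by
    intro s i hi
    rw [← Seq.pad_zero k, Seq.act_pow_pad, Seq.pad_apply, if_pos hi]
  have hcross : ∀ s r : Fin 2, s ≠ r →
      ∀ g ∈ crossGens k (FreeGroup.of s) (FreeGroup.of r),
        ∀ i < k, Seq.zero.act g i = none := by
    intro s r hsr g hg i hi
    rw [← Seq.pad_zero k, Seq.act_crossGens hsr hg, Seq.pad_apply, if_pos hi]
  induction hg using Subgroup.closure_induction with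
  | mem g hg =>
    rcases hg with ((rfl | rfl) | h) | h
    · exact hpow 0
    · exact hpow 1
    · exact hcross 0 1 (by decide) g h
    · exact hcross 1 0 (by decide) g h
  | one => simp [Seq.zero]
  | mul g h _ _ hg hh =>
    intro i hi
    rw [Seq.act_mul, Seq.act_congr h (y := Seq.zero) hg i hi]
    exact hh i hi
  | inv g _ hg =>
    intro i hi
    rw [← Seq.act_congr g⁻¹ (x := Seq.zero.act g) (y := Seq.zero) hg i hi, ← Seq.act_mul,
      mul_inv_cancel, Seq.act_one]
    rfl

/-! ### Coset representatives -/

/-- The group element of a letter: the generator `s` for `some s`, and `1` for `none`. -/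
def letterElt : Option (Fin 2) → F₂
  | none => 1
  | some s => FreeGroup.of s

/-- The element that moves the sequence `zero` to the first `k` letters of `x`; the letters are
written from the last to the first. -/
def cosetRep : ℕ → Seq → F₂
  | 0, _ => 1
  | k + 1, x => letterElt (x k) ^ 2 ^ k * cosetRep k x

theorem cosetRep_congr {k : ℕ} {x y : Seq} (h : ∀ i < k, x i = y i) :
    cosetRep k x = cosetRep k y := by
  induction k with
  | zero => rfl
  | succ k ih =>
    rw [cosetRep, cosetRep, h k k.lt_succ_self, ih fun i hi => h i (hi.trans k.lt_succ_self)]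

theorem cosetRep_eq_one {k : ℕ} {x : Seq} (h : ∀ i < k, x i = none) : cosetRep k x = 1 := by
  induction k with
  | zero => rfl
  | succ k ih =>
    rw [cosetRep, h k k.lt_succ_self, ih fun i hi => h i (hi.trans k.lt_succ_self)]
    simp [letterElt]

/-- The Schreier generator of a carry out of the first `k` letters is a `2 ^ k`-th power. -/
theorem cosetRep_mul_of {k : ℕ} {s : Fin 2} {x : Seq} (h : ∀ i < k, x i = some s) :
    cosetRep k x * FreeGroup.of s = FreeGroup.of s ^ 2 ^ k := by
  induction k with
  | zero => simp [cosetRep]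
  | succ k ih =>
    rw [cosetRep, h k k.lt_succ_self, mul_assoc, ih fun i hi => h i (hi.trans k.lt_succ_self),
      letterElt, ← pow_add, pow_succ, mul_two]

theorem Seq.pad_act_cosetRep (k : ℕ) (x y : Seq) (i : ℕ) :
    (Seq.pad k y).act (cosetRep k x) i = if i < k then x i else y (i - k) := by
  induction k generalizing y with
  | zero => simp [cosetRep, Seq.pad]
  | succ k ih =>
    have h : (Seq.pad k (Seq.cons none y)).act (letterElt (x k) ^ 2 ^ k) =
        Seq.pad k (Seq.cons (x k) y) := by
      cases x k with
      | none => simp [letterElt]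
      | some s => rw [letterElt, Seq.act_pow_pad, Seq.step_cons_none]
    rw [cosetRep, Seq.act_mul, Seq.pad, h, ih]
    rcases lt_trichotomy i k with h | rfl | h
    · simp [h, h.trans k.lt_succ_self]
    · simp [Seq.cons]
    · obtain ⟨d, rfl⟩ := Nat.exists_eq_add_of_lt h
      rw [if_neg (by omega), if_neg (by omega), show k + d + 1 - k = d + 1 by omega,
        show k + d + 1 - (k + 1) = d by omega]
      rfl

theorem Seq.zero_act_cosetRep {k i : ℕ} (x : Seq) (hi : i < k) :
    Seq.zero.act (cosetRep k x) i = x i := by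
  rw [← Seq.pad_zero k, Seq.pad_act_cosetRep, if_pos hi]

/-- The union of the two families of conjugated generators of `G k`. -/
def crossSet (k : ℕ) : Set F₂ := crossGens k a b ∪ crossGens k b a

theorem closure_crossSet_le (k : ℕ) : Subgroup.closure (crossSet k) ≤ G k :=
  Subgroup.closure_mono fun _ h => h.elim (fun h => Or.inl (Or.inr h)) Or.inr

theorem of_pow_mem_G (k : ℕ) (s : Fin 2) : FreeGroup.of s ^ 2 ^ k ∈ G k := by
  refine Subgroup.subset_closure (Or.inl (Or.inl ?_))
  fin_cases s
  · exact Or.inl rfl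
  · exact Or.inr rfl

theorem letterElt_pow_mem_G (k : ℕ) (c : Option (Fin 2)) : letterElt c ^ 2 ^ k ∈ G k := by
  cases c with
  | none => simp [letterElt, one_mem]
  | some s => exact of_pow_mem_G k s

theorem crossSet_eq {s r : Fin 2} (h : s ≠ r) (k : ℕ) : crossSet k =
    crossGens k (FreeGroup.of s) (FreeGroup.of r) ∪
      crossGens k (FreeGroup.of r) (FreeGroup.of s) := by
  fin_cases s <;> fin_cases r
  · exact absurd rfl h
  · rfl
  · exact union_comm _ _
  · exact absurd rfl h

theorem conj_crossSet {k : ℕ} (c : Option (Fin 2)) {g : F₂} (hg : g ∈ crossSet k) :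
    letterElt c ^ 2 ^ k * g * (letterElt c ^ 2 ^ k)⁻¹ ∈ crossSet (k + 1) := by
  cases c with
  | none =>
    simp only [letterElt, one_pow, one_mul, inv_one, mul_one]
    exact hg.imp (fun h => Or.inl (Or.inl h)) (fun h => Or.inl (Or.inl h))
  | some s =>
    obtain ⟨r, hr⟩ := exists_ne s
    rw [crossSet_eq hr.symm] at hg ⊢
    rcases hg with hg | hg
    · exact Or.inl (Or.inl (Or.inr ⟨g, hg, rfl⟩))
    · exact Or.inl (Or.inr ⟨g, Or.inr hg, rfl⟩)

theorem conj_closure_crossSet {k : ℕ} (c : Option (Fin 2)) {g : F₂}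
    (hg : g ∈ Subgroup.closure (crossSet k)) :
    letterElt c ^ 2 ^ k * g * (letterElt c ^ 2 ^ k)⁻¹ ∈ Subgroup.closure (crossSet (k + 1)) := by
  have h : Subgroup.closure (crossSet k) ≤
      (Subgroup.closure (crossSet (k + 1))).comap
        (MulAut.conj (letterElt c ^ 2 ^ k)).toMonoidHom :=
    (Subgroup.closure_le _).2 fun g hg => Subgroup.subset_closure (conj_crossSet c hg)
  exact h hg

/-- The Schreier generators without a carry out of the first `k` letters lie in the subgroup of
the conjugated generators alone, which unlike `G k` is mapped into its successor by the
conjugations with `2 ^ k`-th powers of generators. -/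
theorem schreier_mem_closure_crossSet {k : ℕ} {s : Fin 2} {x : Seq}
    (h : ¬ ∀ i < k, x i = some s) :
    cosetRep k x * FreeGroup.of s * (cosetRep k (x.step s))⁻¹ ∈
      Subgroup.closure (crossSet k) := by
  induction k with
  | zero => exact absurd (fun i hi => absurd hi (Nat.not_lt_zero i)) h
  | succ k ih =>
    by_cases hk : ∀ i < k, x i = some s
    · have hxk : x k ≠ some s := fun hxk => h fun i hi =>
        (Nat.lt_succ_iff_lt_or_eq.1 hi).elim (hk i) fun h => h ▸ hxk
      have h1 : cosetRep k (x.step s) = 1 := cosetRep_eq_one ((Seq.carry_step s x k).2 hk)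
      rw [cosetRep, cosetRep, h1, mul_assoc (letterElt _ ^ _), cosetRep_mul_of hk,
        Seq.step_apply, if_pos hk, mul_one]
      cases hc : x k with
      | none => simp [letterElt, one_mem]
      | some r =>
        have hr : r ≠ s := fun h => hxk (h ▸ hc)
        rw [Equiv.swap_apply_of_ne_of_ne (by simp) (by simpa using hr)]
        refine Subgroup.subset_closure ?_
        rw [crossSet_eq hr]
        exact Or.inl (Or.inr ⟨_, Or.inl rfl, rfl⟩)
    · have := conj_closure_crossSet (x k) (ih hk)
      rw [cosetRep, cosetRep, Seq.step_apply, if_neg hk]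
      convert this using 1
      group

theorem schreier_mem_G (k : ℕ) (s : Fin 2) (x : Seq) :
    cosetRep k x * FreeGroup.of s * (cosetRep k (x.step s))⁻¹ ∈ G k := by
  by_cases h : ∀ i < k, x i = some s
  · rw [cosetRep_mul_of h, cosetRep_eq_one ((Seq.carry_step s x k).2 h), inv_one, mul_one]
    exact of_pow_mem_G k s
  · exact closure_crossSet_le k (schreier_mem_closure_crossSet h)

/-! ### Sequences as coherent vertices -/

theorem Vertex.mk_eq_mk {H : Subgroup F₂} {g h : F₂} :
    Vertex.mk H g = Vertex.mk H h ↔ h * g⁻¹ ∈ H := by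
  rw [← QuotientGroup.rightRel_apply]
  exact Quotient.eq

/-- The vertex of the `k`-th Schreier graph that is named by the first `k` letters of `x`. -/
def Seq.vertex (k : ℕ) (x : Seq) : Vertex (G k) := Vertex.mk (G k) (cosetRep k x)

theorem Seq.vertex_zero (k : ℕ) : Seq.zero.vertex k = Vertex.mk (G k) 1 := by
  rw [Seq.vertex, cosetRep_eq_one (x := Seq.zero) fun _ _ => rfl]

theorem Seq.step_vertex (k : ℕ) (s : Fin 2) (x : Seq) :
    (x.vertex k).step s = (x.step s).vertex k := by
  change Vertex.mk (G k) (cosetRep k x * FreeGroup.of s) = _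
  refine Vertex.mk_eq_mk.2 ?_
  rw [← inv_mem_iff]
  simpa using schreier_mem_G k s x

theorem Seq.map_vertex (k : ℕ) (x : Seq) :
    Vertex.map (G_succ_le k) (x.vertex (k + 1)) = x.vertex k := by
  change Vertex.mk (G k) (cosetRep (k + 1) x) = _
  refine Vertex.mk_eq_mk.2 ?_
  rw [← inv_mem_iff]
  simpa [cosetRep] using letterElt_pow_mem_G k (x k)

theorem Seq.zero_act_congr {k : ℕ} {g h : F₂} (hgh : Vertex.mk (G k) g = Vertex.mk (G k) h) :
    ∀ i < k, Seq.zero.act g i = Seq.zero.act h i := by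
  intro i hi
  have := Seq.act_congr g (x := Seq.zero.act (h * g⁻¹)) (y := Seq.zero)
    (Seq.zero_act_of_mem_G (Vertex.mk_eq_mk.1 hgh)) i hi
  rw [← this, ← Seq.act_mul, inv_mul_cancel_right]

theorem Seq.vertex_injective {x y : Seq} (h : ∀ k, x.vertex k = y.vertex k) : x = y := by
  funext i
  rw [← Seq.zero_act_cosetRep x i.lt_succ_self, ← Seq.zero_act_cosetRep y i.lt_succ_self]
  exact Seq.zero_act_congr (h (i + 1)) i i.lt_succ_self

/-- The orbit map of the sequence `zero` is compatible with the projections of the free group to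
the vertices. -/
theorem Seq.vertex_zero_act (k : ℕ) (g : F₂) :
    (Seq.zero.act g).vertex k = Vertex.mk (G k) g := by
  have key : ∀ x : Seq, (x.act g).vertex k = Vertex.mk (G k) (cosetRep k x * g) := by
    have hof : ∀ s (x : Seq),
        (x.act (FreeGroup.of s)).vertex k = Vertex.mk (G k) (cosetRep k x * FreeGroup.of s) :=
      fun s x => by rw [Seq.act_of, ← Seq.step_vertex]; rfl
    induction g using FreeGroup.induction_on with
    | C1 => simp [Seq.vertex]
    | of s => exact hof s
    | inv_of s _ =>
      intro x
      have h := hof s (x.act (FreeGroup.of s)⁻¹)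
      rw [← Seq.act_mul, inv_mul_cancel, Seq.act_one] at h
      refine Vertex.mk_eq_mk.2 ?_
      have h := Vertex.mk_eq_mk.1 h
      rw [← inv_mem_iff]
      simpa [mul_assoc] using h
    | mul g h hg hh =>
      intro x
      have h1 := Vertex.mk_eq_mk.1 (hg x)
      rw [Seq.act_mul, hh]
      refine Vertex.mk_eq_mk.2 ?_
      simpa [mul_assoc] using h1
  rw [key, cosetRep_eq_one (x := Seq.zero) fun _ _ => rfl, one_mul]

/-- Every coherent sequence of vertices comes from a sequence of letters. -/
theorem Seq.exists_vertex_eq (v : ∀ k, Vertex (G k))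
    (hv : ∀ k, Vertex.map (G_succ_le k) (v (k + 1)) = v k) : ∃ x : Seq, ∀ k, x.vertex k = v k := by
  choose g hg using fun k => Quotient.exists_rep (v k)
  change ∀ k, Vertex.mk (G k) (g k) = v k at hg
  have hstep : ∀ k, Vertex.mk (G k) (g (k + 1)) = Vertex.mk (G k) (g k) := by
    intro k
    rw [hg k, ← hv k, ← hg (k + 1)]
    rfl
  have hle : ∀ i k, i < k → Seq.zero.act (g k) i = Seq.zero.act (g (i + 1)) i := by
    intro i k hk
    induction k, hk using Nat.le_induction with
    | base => rfl
    | succ k hk ih => rw [← ih, Seq.zero_act_congr (hstep k) i hk]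
  refine ⟨fun i => Seq.zero.act (g (i + 1)) i, fun k => ?_⟩
  rw [← hg k, ← Seq.vertex_zero_act, Seq.vertex, Seq.vertex, cosetRep_congr]
  exact fun i hi => (hle i k hi).symm

/-! ### The four arms -/

/-- The sequences that are constant from the index `n` on. -/
def ball (n : ℕ) : Set Seq := {x | ∃ c, ∀ i, n ≤ i → x i = c}

/-- The eventually constant sequences. -/
def leafSeq : Set Seq := ⋃ n, ball n

/-- The part outside `ball n` of the arm `(s, true)`, where `some s` is the last letter other than
`none`, and of the arm `(s, false)`, where the letters are eventually `some s`. -/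
def arm (n : ℕ) (j : Fin 2 × Bool) : Set Seq :=
  {x | ∃ p ≥ n, (x p = some j.1 ↔ j.2 = true) ∧
    ∀ i > p, x i = if j.2 then none else some j.1}

theorem ball_mono : Monotone ball := fun _ _ h _ ⟨c, hc⟩ => ⟨c, fun i hi => hc i (h.trans hi)⟩

theorem finite_ball (n : ℕ) : (ball n).Finite := by
  have h : ball n ⊆ range fun q : (Fin n → Option (Fin 2)) × Option (Fin 2) =>
      (fun i => if h : i < n then q.1 ⟨i, h⟩ else q.2 : Seq) := by
    rintro x ⟨c, hc⟩
    refine ⟨(fun i => x i, c), funext fun i => ?_⟩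
    by_cases hi : i < n
    · simp [hi]
    · simp [hi, hc i (not_lt.1 hi)]
  exact (finite_range _).subset h

theorem step_eventually {s : Fin 2} {x : Seq} {m : ℕ} (hm : x m ≠ some s) :
    ∀ i > m, x.step s i = x i := fun i hi => by
  rw [Seq.step_apply, if_neg fun h => hm (h m hi)]

theorem step_mem_leafSeq {s : Fin 2} {x : Seq} : x.step s ∈ leafSeq ↔ x ∈ leafSeq := by
  simp only [leafSeq, mem_iUnion]
  by_cases h : ∃ m, x m ≠ some s
  · obtain ⟨m, hm⟩ := h
    constructor
    · rintro ⟨n, c, hc⟩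
      exact ⟨max n (m + 1), c, fun i hi => by
        rw [← step_eventually hm i (by omega), hc i (by omega)]⟩
    · rintro ⟨n, c, hc⟩
      exact ⟨max n (m + 1), c, fun i hi => by
        rw [step_eventually hm i (by omega), hc i (by omega)]⟩
  · push Not at h
    refine ⟨fun _ => ⟨0, some s, fun i _ => h i⟩, fun _ => ⟨0, none, fun i _ => ?_⟩⟩
    exact (Seq.carry_step s x (i + 1)).2 (fun j _ => h j) i i.lt_succ_self

theorem arm_antitone (j : Fin 2 × Bool) : Antitone fun n => arm n j :=
  fun _ _ h _ ⟨p, hp, hx⟩ => ⟨p, h.trans hp, hx⟩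

theorem arm_subset_leafSeq (n : ℕ) (j : Fin 2 × Bool) : arm n j ⊆ leafSeq :=
  fun _ ⟨p, _, _, hx⟩ => mem_iUnion.2 ⟨p + 1, _, fun i hi => hx i hi⟩

theorem notMem_ball_of_mem_arm {n : ℕ} {j : Fin 2 × Bool} {x : Seq} (hx : x ∈ arm n j) :
    x ∉ ball n := by
  rintro ⟨c, hc⟩
  obtain ⟨p, hp, h1, h2⟩ := hx
  have h3 := h2 (p + 1) p.lt_succ_self
  rw [hc _ (hp.trans p.le_succ), ← hc p hp] at h3
  rw [h3] at h1
  obtain ⟨s, _ | _⟩ := j <;> simp at h1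

theorem mem_ball_or_arm {n : ℕ} {x : Seq} (hx : x ∈ leafSeq) : x ∈ ball n ∨ ∃ j, x ∈ arm n j := by
  classical
  have hx : ∃ m, x ∈ ball m := mem_iUnion.1 hx
  by_cases hn : Nat.find hx ≤ n
  · exact Or.inl (ball_mono hn (Nat.find_spec hx))
  right
  obtain ⟨p, hp⟩ : ∃ p, Nat.find hx = p + 1 := Nat.exists_eq_succ_of_ne_zero (by omega)
  obtain ⟨c, hc⟩ := hp ▸ Nat.find_spec hx
  have hpc : x p ≠ c := fun h => Nat.find_min hx (m := p) (by omega) ⟨c, fun i hi => by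
    rcases hi.eq_or_lt with rfl | hi
    · exact h
    · exact hc i hi⟩
  cases c with
  | none =>
    obtain ⟨s, hs⟩ := Option.ne_none_iff_exists'.1 hpc
    exact ⟨(s, true), p, by omega, by simpa using hs, fun i hi => by simpa using hc i hi⟩
  | some s => exact ⟨(s, false), p, by omega, by simpa using hpc, fun i hi => by
      simpa using hc i hi⟩

theorem arm_zero_unique {j j' : Fin 2 × Bool} {x : Seq} (h : x ∈ arm 0 j) (h' : x ∈ arm 0 j') :
    j = j' := by
  obtain ⟨s, e⟩ := j
  obtain ⟨s', e'⟩ := j'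
  obtain ⟨p, -, h1, h2⟩ := h
  obtain ⟨p', -, h1', h2'⟩ := h'
  have h3 := h2 (max p p' + 1) (by omega)
  rw [h2' (max p p' + 1) (by omega)] at h3
  rcases lt_trichotomy p p' with h | rfl | h
  · have := h2 p' h
    cases e <;> cases e' <;> simp_all
  · cases e <;> cases e' <;> simp_all
  · have := h2' p h
    cases e <;> cases e' <;> simp_all

theorem arm_eq_of_eventually {j : Fin 2 × Bool} {r : Fin 2} {m : ℕ} {x : Seq} (h : x ∈ arm 0 j)
    (hx : ∀ i > m, x i = some r) : j = (r, false) := by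
  obtain ⟨s, e⟩ := j
  obtain ⟨p, -, -, h2⟩ := h
  have h3 := h2 (max p m + 1) (by omega)
  rw [hx _ (by omega)] at h3
  cases e <;> simp_all

/-- An edge between two arms would have to pass through a constant sequence. -/
theorem arm_eq_of_step {j j' : Fin 2 × Bool} {s : Fin 2} {x : Seq} (h : x ∈ arm 0 j)
    (h' : x.step s ∈ arm 0 j') : j = j' := by
  obtain ⟨r, _ | _⟩ := j
  · obtain ⟨p, -, h1, h2⟩ := h
    simp only [Bool.false_eq_true, iff_false, if_false] at h1 h2
    by_cases hrs : r = s
    · subst hrs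
      exact (arm_eq_of_eventually h' fun i hi => by rw [step_eventually h1 i hi, h2 i hi]).symm
    · have h3 : x (p + 1) ≠ some s := by simpa [h2 (p + 1) p.lt_succ_self] using hrs
      exact (arm_eq_of_eventually (m := p + 1) h' fun i hi => by
        rw [step_eventually h3 i hi, h2 i (by omega)]).symm
  refine arm_zero_unique (x := x.step s) ?_ h'
  obtain ⟨p, -, h1, h2⟩ := h
  simp only [iff_true, if_true] at h1 h2
  by_cases hp : ∀ j < p + 1, x j = some s
  · -- The carry passes the index `p` and stops right after it.
    have hr : r = s := by simpa [hp p p.lt_succ_self, eq_comm] using h1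
    subst hr
    have h3 : x (p + 1) = none := h2 (p + 1) p.lt_succ_self
    refine ⟨p + 1, Nat.zero_le _, ?_, fun i hi => ?_⟩
    · rw [Seq.step_apply, if_pos hp, h3]; simp
    · rw [step_eventually (m := p + 1) (by simp [h3]) i hi]
      exact h2 i (by omega)
  · push Not at hp
    obtain ⟨m, hm, hms⟩ := hp
    refine ⟨p, Nat.zero_le _, ?_, fun i hi => ?_⟩
    · simp only [iff_true]
      by_cases hmp : m = p
      · subst hmp
        rw [Seq.step_apply]
        split_ifs
        · rw [h1, Equiv.swap_apply_of_ne_of_ne (by simp) (h1 ▸ hms)]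
        · exact h1
      · rw [step_eventually hms p (by omega)]; exact h1
    · rw [step_eventually hms i (by omega)]
      exact h2 i hi

/-! ### Connectedness of the arms -/

/-- A set of sequences is step-connected if the graph is connected whose edges join `x` and
`x.step s` when both lie in the set: a property that is passed on along edges in both directions
holds everywhere as soon as it holds somewhere. -/
def StepConnected (A : Set Seq) : Prop :=
  ∀ T : Set Seq, (∀ x ∈ A, ∀ s : Fin 2, x.step s ∈ A → (x ∈ T ↔ x.step s ∈ T)) →
    ∀ x ∈ A, ∀ y ∈ A, x ∈ T → y ∈ T

theorem StepConnected.union {A B : Set Seq} (hA : StepConnected A) (hB : StepConnected B)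
    {x : Seq} {s : Fin 2} (h : x ∈ A ∧ x.step s ∈ B) : StepConnected (A ∪ B) := by
  intro T hT
  have hTA := hA T fun y hy r hyr => hT y (Or.inl hy) r (Or.inl hyr)
  have hTB := hB T fun y hy r hyr => hT y (Or.inr hy) r (Or.inr hyr)
  have hx := hT x (Or.inl h.1) s (Or.inr h.2)
  rintro y (hy | hy) z (hz | hz) hyT
  · exact hTA y hy z hz hyT
  · exact hTB _ h.2 z hz (hx.1 (hTA y hy x h.1 hyT))
  · exact hTA _ h.1 z hz (hx.2 (hTB y hy _ h.2 hyT))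
  · exact hTB y hy z hz hyT

theorem StepConnected.union_of_inter {A B : Set Seq} (hA : StepConnected A)
    (hB : StepConnected B) (h : (A ∩ B).Nonempty) : StepConnected (A ∪ B) := by
  obtain ⟨x, hxA, hxB⟩ := h
  intro T hT
  have hTA := hA T fun y hy r hyr => hT y (Or.inl hy) r (Or.inl hyr)
  have hTB := hB T fun y hy r hyr => hT y (Or.inr hy) r (Or.inr hyr)
  rintro y (hy | hy) z (hz | hz) hyT
  · exact hTA y hy z hz hyT
  · exact hTB _ hxB z hz (hTA y hy x hxA hyT)
  · exact hTA _ hxA z hz (hTB y hy _ hxB hyT)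
  · exact hTB y hy z hz hyT

theorem StepConnected.iUnion_of_chain {A : ℕ → Set Seq} (hA : ∀ n, StepConnected (A n))
    (hlink : ∀ n, (∃ x ∈ A n, ∃ s : Fin 2, x.step s ∈ A (n + 1)) ∨
      ∃ x ∈ A (n + 1), ∃ s : Fin 2, x.step s ∈ A n) : StepConnected (⋃ n, A n) := by
  intro T hT
  have hTA : ∀ n, ∀ y ∈ A n, ∀ z ∈ A n, y ∈ T → z ∈ T := fun n =>
    hA n T fun y hy r hyr => hT y (mem_iUnion_of_mem n hy) r (mem_iUnion_of_mem n hyr)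
  have hTlink : ∀ n, ∃ y ∈ A n, ∃ z ∈ A (n + 1), y ∈ T ↔ z ∈ T := by
    intro n
    rcases hlink n with ⟨x, hx, s, hxs⟩ | ⟨x, hx, s, hxs⟩
    · exact ⟨x, hx, _, hxs, hT x (mem_iUnion_of_mem _ hx) s (mem_iUnion_of_mem _ hxs)⟩
    · exact ⟨_, hxs, x, hx, (hT x (mem_iUnion_of_mem _ hx) s (mem_iUnion_of_mem _ hxs)).symm⟩
  obtain ⟨x, hx, -⟩ := hTlink 0
  have h0 : ∀ n, ∀ y ∈ A n, x ∈ T ↔ y ∈ T := by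
    intro n
    induction n with
    | zero => exact fun y hy => ⟨hTA 0 x hx y hy, hTA 0 y hy x hx⟩
    | succ n ih =>
      obtain ⟨z, hz, w, hw, hzw⟩ := hTlink n
      intro y hy
      rw [ih z hz, hzw]
      exact ⟨hTA _ w hw y hy, hTA _ y hy w hw⟩
  intro y hy z hz hyT
  obtain ⟨n, hy⟩ := mem_iUnion.1 hy
  obtain ⟨m, hz⟩ := mem_iUnion.1 hz
  exact (h0 m z hz).1 ((h0 n y hy).2 hyT)

/-- The sequences that agree with `y` from the index `p` on. -/
def block (p : ℕ) (y : Seq) : Set Seq := {x | ∀ i ≥ p, x i = y i}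

/-- The sequence of `p` letters `c`, followed by the letters of `y` from the index `p` on. -/
def fill (p : ℕ) (c : Option (Fin 2)) (y : Seq) : Seq := fun i => if i < p then c else y i

theorem fill_mem_block (p : ℕ) (c : Option (Fin 2)) (y : Seq) : fill p c y ∈ block p y :=
  fun i hi => by simp [fill, not_lt.2 hi]

/-- The step out of the block of length `p` changes the next letter `none` to `some s`. -/
theorem step_fill_mem_block {p : ℕ} {s : Fin 2} {y z : Seq} (hy : y p = none)
    (hz : z p = some s) (hyz : ∀ i > p, z i = y i) : (fill p (some s) y).step s ∈ block p z := by
  have hp : fill p (some s) y p = none := by simp [fill, hy]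
  intro i hi
  rcases (show p ≤ i from hi).eq_or_lt with rfl | hi
  · rw [Seq.step_apply, if_pos fun j hj => by simp [fill, hj], hp, hz, Equiv.swap_apply_left]
  · rw [step_eventually (m := p) (by simp [hp]) i hi, fill_mem_block _ _ _ i hi.le, hyz i hi]

/-- A block of length `p + 1` is the union of three blocks of length `p`, one for each value of the
letter at the index `p`; two edges join the one with the letter `none` to the others. -/
theorem stepConnected_block (p : ℕ) (y : Seq) : StepConnected (block p y) := by
  induction p generalizing y with
  | zero =>
    intro T _ x hx z hz hxT
    rwa [funext fun i => (hz i (Nat.zero_le _)).trans (hx i (Nat.zero_le _)).symm]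
  | succ p ih =>
    have h1 : ∀ s : Fin 2, StepConnected
        (block p (Function.update y p none) ∪ block p (Function.update y p (some s))) := fun s =>
      (ih _).union (ih _) ⟨fill_mem_block p (some s) _, step_fill_mem_block (by simp) (by simp)
        fun i hi => by simp [hi.ne']⟩
    have h2 := (h1 0).union_of_inter (h1 1) ⟨_, Or.inl fun i _ => rfl, Or.inl fun i _ => rfl⟩
    convert h2 using 1
    ext x
    constructor
    · intro hx
      have hx' : x ∈ block p (Function.update y p (x p)) := by
        intro i hi
        rcases (show p ≤ i from hi).eq_or_lt with rfl | hi
        · simp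
        · rw [Function.update_of_ne hi.ne']; exact hx i hi
      rcases hc : x p with _ | s
      · exact Or.inl (Or.inl (hc ▸ hx'))
      · rw [hc] at hx'
        fin_cases s
        · exact Or.inl (Or.inr hx')
        · exact Or.inr (Or.inr hx')
    · have : ∀ c, x ∈ block p (Function.update y p c) → x ∈ block (p + 1) y := fun c hx i hi => by
        rw [hx i (by omega), Function.update_of_ne (by omega)]
      rintro ((hx | hx) | (hx | hx)) <;> exact this _ hx

theorem mem_block_update {p : ℕ} {c : Option (Fin 2)} {x y : Seq} :
    x ∈ block p (Function.update y p c) ↔ x p = c ∧ ∀ i > p, x i = y i := by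
  constructor
  · intro h
    exact ⟨by simpa using h p le_rfl, fun i hi => by
      rw [h i (le_of_lt hi), Function.update_of_ne (ne_of_gt hi)]⟩
  · rintro ⟨h1, h2⟩ i hi
    rcases (show p ≤ i from hi).eq_or_lt with rfl | hi
    · simpa using h1
    · rw [Function.update_of_ne hi.ne', h2 i hi]

/-- The sequences of the arm `j` whose last letter off the final constant has the index `p`. -/
def armLayer (j : Fin 2 × Bool) (p : ℕ) : Set Seq :=
  {x | (x p = some j.1 ↔ j.2 = true) ∧ ∀ i > p, x i = if j.2 then none else some j.1}

theorem arm_eq_iUnion (n : ℕ) (j : Fin 2 × Bool) : arm n j = ⋃ d, armLayer j (n + d) := by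
  ext x
  simp only [mem_iUnion]
  constructor
  · rintro ⟨p, hp, hx⟩
    obtain ⟨d, rfl⟩ := Nat.exists_eq_add_of_le hp
    exact ⟨d, hx⟩
  · rintro ⟨d, hx⟩
    exact ⟨n + d, Nat.le_add_right n d, hx⟩

theorem stepConnected_armLayer (j : Fin 2 × Bool) (p : ℕ) : StepConnected (armLayer j p) := by
  obtain ⟨s, _ | _⟩ := j
  · obtain ⟨r, hr⟩ := exists_ne s
    have h : armLayer (s, false) p = block p (Function.update (fun _ => some s) p none) ∪
        block p (Function.update (fun _ => some s) p (some r)) := by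
      ext x
      have hx : x p ≠ some s ↔ x p = none ∨ x p = some r := by
        rcases x p with _ | t
        · simp
        · simp only [ne_eq, Option.some.injEq, reduceCtorEq, false_or]
          omega
      rw [mem_union, mem_block_update, mem_block_update, ← or_and_right, ← hx]
      simp [armLayer]
    rw [h]
    exact (stepConnected_block _ _).union (stepConnected_block _ _)
      ⟨fill_mem_block p (some r) _, step_fill_mem_block (by simp) (by simp)
        fun i hi => by simp [hi.ne']⟩
  · have h : armLayer (s, true) p = block p (Function.update Seq.zero p (some s)) := by
      ext x
      rw [mem_block_update]
      simp [armLayer, Seq.zero]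
    rw [h]
    exact stepConnected_block _ _

theorem stepConnected_arm (n : ℕ) (j : Fin 2 × Bool) : StepConnected (arm n j) := by
  rw [arm_eq_iUnion]
  refine StepConnected.iUnion_of_chain (fun d => stepConnected_armLayer j _) fun d => ?_
  rw [← Nat.add_assoc]
  set p := n + d
  obtain ⟨s, _ | _⟩ := j
  · -- The odometer maps `p + 1` letters `some s`, one `none` and then `some s` forever to
    -- `p + 1` letters `none` and then `some s` forever.
    refine Or.inr
      ⟨fill (p + 1) (some s) (Function.update (fun _ => some s) (p + 1) none), ?_, s, ?_⟩
    · refine ⟨by simp [fill], fun i hi => ?_⟩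
      have h1 : ¬ i < p + 1 := by omega
      have h2 : i ≠ p + 1 := by omega
      simp [fill, h1, h2]
    · have h := step_fill_mem_block (p := p + 1) (s := s)
        (y := Function.update (fun _ => some s) (p + 1) none) (z := fun _ => some s) (by simp) rfl
        fun i hi => by simp [(ne_of_gt hi)]
      refine ⟨?_, fun i hi => by simpa using h i hi⟩
      have : (fill (p + 1) (some s) (Function.update (fun _ => some s) (p + 1) none)).step s p
          = none := (Seq.carry_step s _ (p + 1)).2 (fun j hj => by simp [fill, hj]) p
            p.lt_succ_self
      simp [this]
  · refine Or.inl ⟨fill (p + 1) (some s) Seq.zero, ?_, s, ?_⟩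
    · refine ⟨by simp [fill], fun i hi => ?_⟩
      have h1 : ¬ i < p + 1 := by omega
      simp [fill, h1, Seq.zero]
    · have h := step_fill_mem_block (p := p + 1) (s := s) (y := Seq.zero)
        (z := Function.update Seq.zero (p + 1) (some s)) rfl (by simp)
        fun i hi => by simp [(ne_of_gt hi)]
      have h := mem_block_update.1 h
      exact ⟨by simp [h.1], fun i hi => by simpa [Seq.zero] using h.2 i hi⟩

theorem arm_nonempty (n : ℕ) (j : Fin 2 × Bool) : (arm n j).Nonempty := by
  obtain ⟨s, _ | _⟩ := j
  · exact ⟨Function.update (fun _ => some s) n none, n, le_rfl, by simp, fun i hi => by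
      simp [(ne_of_gt hi)]⟩
  · exact ⟨Function.update Seq.zero n (some s), n, le_rfl, by simp, fun i hi => by
      simp [(ne_of_gt hi), Seq.zero]⟩

theorem stepConnected_ball (n : ℕ) : StepConnected (ball n) := by
  have h1 : ∀ s : Fin 2, StepConnected (block n (fun _ => some s) ∪ block n Seq.zero) := by
    refine fun s => (stepConnected_block _ _).union (stepConnected_block _ _)
      (x := fun _ => some s) (s := s) ⟨fun i _ => rfl, fun i _ => ?_⟩
    exact (Seq.carry_step s _ (i + 1)).2 (fun _ _ => rfl) i i.lt_succ_self
  have h2 := (h1 0).union_of_inter (h1 1) ⟨_, Or.inr fun i _ => rfl, Or.inr fun i _ => rfl⟩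
  convert h2 using 1
  ext x
  constructor
  · rintro ⟨_ | s, hc⟩
    · exact Or.inl (Or.inr hc)
    · fin_cases s
      · exact Or.inl (Or.inl hc)
      · exact Or.inr (Or.inl hc)
  · rintro ((hx | hx) | (hx | hx)) <;> exact ⟨_, hx⟩

theorem stepConnected_leafSeq : StepConnected leafSeq := by
  intro T hT x hx y hy hxT
  obtain ⟨n, hx⟩ := mem_iUnion.1 hx
  obtain ⟨m, hy⟩ := mem_iUnion.1 hy
  exact stepConnected_ball (max n m) T
    (fun z hz s hzs => hT z (mem_iUnion_of_mem _ hz) s (mem_iUnion_of_mem _ hzs))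
    x (ball_mono (le_max_left n m) hx) y (ball_mono (le_max_right n m) hy) hxT

/-! ### Points and open sets of a Schreier graph -/

section Graph

variable {H : Subgroup F₂}

/-- The point at time `t` on the edge labelled `s` that starts at `v`. -/
def SchreierGraph.edge (v : Vertex H) (s : Fin 2) (t : unitInterval) : SchreierGraph H :=
  Quot.mk _ (Sum.inr (v, s, t))

theorem SchreierGraph.edge_zero (v : Vertex H) (s : Fin 2) :
    SchreierGraph.edge v s 0 = SchreierGraph.vertex v := Quot.sound (Glue.source v s)

theorem SchreierGraph.edge_one (v : Vertex H) (s : Fin 2) :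
    SchreierGraph.edge v s 1 = SchreierGraph.vertex (v.step s) := Quot.sound (Glue.target v s)

theorem SchreierGraph.continuous_edge (v : Vertex H) (s : Fin 2) :
    Continuous (SchreierGraph.edge v s) :=
  continuous_quot_mk.comp (continuous_inr.comp
    (continuous_const.prodMk (continuous_const.prodMk continuous_id)))

/-- The unique way to write a point as a point on an edge, with the vertices placed at the start
of their edges labelled `0`. -/
noncomputable def SchreierGraph.coord : SchreierGraph H → Vertex H × Fin 2 × unitInterval :=
  Quot.lift (Sum.elim (fun v => (v, 0, 0)) fun q =>
      if q.2.2 = 1 then (q.1.step q.2.1, 0, 0) else if q.2.2 = 0 then (q.1, 0, 0) else q) (by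
    rintro _ _ (⟨v, s⟩ | ⟨v, s⟩) <;> simp)

theorem SchreierGraph.edge_coord (q : SchreierGraph H) :
    SchreierGraph.edge q.coord.1 q.coord.2.1 q.coord.2.2 = q := by
  obtain ⟨v | ⟨v, s, t⟩, rfl⟩ := Quot.exists_rep q
  · exact SchreierGraph.edge_zero (H := H) v 0
  · change SchreierGraph.edge
      (if t = 1 then (v.step s, 0, 0) else if t = 0 then (v, 0, 0) else (v, s, t)).1
      (if t = 1 then (v.step s, 0, 0) else if t = 0 then (v, 0, 0) else (v, s, t)).2.1
      (if t = 1 then (v.step s, 0, 0) else if t = 0 then (v, 0, 0) else (v, s, t)).2.2 =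
      SchreierGraph.edge v s t
    split_ifs with h1 h0
    · rw [h1]; exact (SchreierGraph.edge_zero _ 0).trans (SchreierGraph.edge_one v s).symm
    · rw [h0]; exact (SchreierGraph.edge_zero v 0).trans (SchreierGraph.edge_zero v s).symm
    · rfl

theorem Vertex.map_step {K : Subgroup F₂} (h : H ≤ K) (v : Vertex H) (s : Fin 2) :
    Vertex.map h (v.step s) = (Vertex.map h v).step s := by
  obtain ⟨g, rfl⟩ := Quotient.exists_rep v
  rfl

theorem SchreierGraph.coord_map {K : Subgroup F₂} (h : H ≤ K) (q : SchreierGraph H) :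
    (SchreierGraph.map h q).coord = (Vertex.map h q.coord.1, q.coord.2) := by
  obtain ⟨v | ⟨v, s, t⟩, rfl⟩ := Quot.exists_rep q
  · rfl
  · change (if t = 1 then ((Vertex.map h v).step s, 0, 0) else
        if t = 0 then (Vertex.map h v, 0, 0) else (Vertex.map h v, s, t)) =
      (Vertex.map h (if t = 1 then (v.step s, 0, 0) else if t = 0 then (v, 0, 0) else (v, s, t)).1,
      (if t = 1 then (v.step s, 0, 0) else if t = 0 then (v, 0, 0) else (v, s, t)).2)
    split_ifs <;> simp [Vertex.map_step]

/-- The points at distance less than `1 / 2` from a vertex in `A`. -/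
def SchreierGraph.halfStar (A : Set (Vertex H)) : Set (SchreierGraph H) :=
  Quot.lift (Sum.elim (fun v => v ∈ A) fun q =>
      ((q.2.2 : ℝ) < 1 / 2 ∧ q.1 ∈ A) ∨ (1 / 2 < (q.2.2 : ℝ) ∧ q.1.step q.2.1 ∈ A)) (by
    rintro _ _ (⟨v, s⟩ | ⟨v, s⟩) <;> norm_num)

/-- The points in the interior of the edges in `A`. -/
def SchreierGraph.openEdge (A : Set (Vertex H × Fin 2)) : Set (SchreierGraph H) :=
  Quot.lift (Sum.elim (fun _ => False) fun q =>
      (0 < q.2.2 ∧ q.2.2 < 1) ∧ (q.1, q.2.1) ∈ A) (by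
    rintro _ _ (⟨v, s⟩ | ⟨v, s⟩) <;> simp)

theorem SchreierGraph.edge_mem_halfStar {A : Set (Vertex H)} {v : Vertex H} {s : Fin 2}
    {t : unitInterval} : SchreierGraph.edge v s t ∈ SchreierGraph.halfStar A ↔
      ((t : ℝ) < 1 / 2 ∧ v ∈ A) ∨ (1 / 2 < (t : ℝ) ∧ v.step s ∈ A) := Iff.rfl

theorem SchreierGraph.edge_mem_openEdge {A : Set (Vertex H × Fin 2)} {v : Vertex H} {s : Fin 2}
    {t : unitInterval} : SchreierGraph.edge v s t ∈ SchreierGraph.openEdge A ↔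
      (0 < t ∧ t < 1) ∧ (v, s) ∈ A := Iff.rfl

theorem SchreierGraph.isOpen_of_edge {U : Set (SchreierGraph H)}
    (h : IsOpen {q : Vertex H × Fin 2 × unitInterval | SchreierGraph.edge q.1 q.2.1 q.2.2 ∈ U}) :
    IsOpen U := by
  refine isOpen_coinduced.2 (isOpen_sum_iff.2 ⟨isOpen_discrete _, h⟩)

theorem SchreierGraph.isOpen_halfStar (A : Set (Vertex H)) :
    IsOpen (SchreierGraph.halfStar A) := by
  refine SchreierGraph.isOpen_of_edge ?_
  have ht : Continuous fun q : Vertex H × Fin 2 × unitInterval => (q.2.2 : ℝ) := by fun_prop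
  have hv : Continuous fun q : Vertex H × Fin 2 × unitInterval => (q.1, q.2.1) := by fun_prop
  exact ((isOpen_lt ht continuous_const).inter
      ((isOpen_discrete {w : Vertex H × Fin 2 | w.1 ∈ A}).preimage hv)).union
    ((isOpen_lt continuous_const ht).inter
      ((isOpen_discrete {w : Vertex H × Fin 2 | w.1.step w.2 ∈ A}).preimage hv))

theorem SchreierGraph.isOpen_openEdge (A : Set (Vertex H × Fin 2)) :
    IsOpen (SchreierGraph.openEdge A) := by
  refine SchreierGraph.isOpen_of_edge ?_
  have ht : Continuous fun q : Vertex H × Fin 2 × unitInterval => q.2.2 := by fun_prop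
  have hv : Continuous fun q : Vertex H × Fin 2 × unitInterval => (q.1, q.2.1) := by fun_prop
  exact ((isOpen_lt continuous_const ht).inter (isOpen_lt ht continuous_const)).inter
    ((isOpen_discrete A).preimage hv)

end Graph

/-! ### Points and leaf-open sets of the continuum -/

theorem continuous_proj (k : ℕ) : Continuous fun p : Continuum => p.1 k :=
  (continuous_apply k).comp continuous_subtype_val

/-- The point of the continuum at time `t` on the edge labelled `s` that starts at the vertex
named by the sequence `x`. -/
def edgePoint (x : Seq) (s : Fin 2) (t : unitInterval) : Continuum :=
  ⟨fun k => SchreierGraph.edge (x.vertex k) s t, fun k =>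
    congrArg (fun v => SchreierGraph.edge v s t) (x.map_vertex k)⟩

theorem continuous_edgePoint (x : Seq) (s : Fin 2) : Continuous (edgePoint x s) :=
  Continuous.subtype_mk (continuous_pi fun k => SchreierGraph.continuous_edge (x.vertex k) s) _

theorem edgePoint_zero (x : Seq) (s r : Fin 2) : edgePoint x s 0 = edgePoint x r 0 :=
  Subtype.ext (funext fun k =>
    (SchreierGraph.edge_zero (x.vertex k) s).trans (SchreierGraph.edge_zero (x.vertex k) r).symm)

theorem edgePoint_one (x : Seq) (s r : Fin 2) : edgePoint x s 1 = edgePoint (x.step s) r 0 :=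
  Subtype.ext (funext fun k => by
    change SchreierGraph.edge (x.vertex k) s 1 = SchreierGraph.edge ((x.step s).vertex k) r 0
    rw [SchreierGraph.edge_one, SchreierGraph.edge_zero, Seq.step_vertex])

theorem idPoint_eq (s : Fin 2) : idPoint = edgePoint Seq.zero s 0 :=
  Subtype.ext (funext fun k => by
    change SchreierGraph.vertex (Vertex.mk (G k) 1) = SchreierGraph.edge (Seq.zero.vertex k) s 0
    rw [SchreierGraph.edge_zero, Seq.vertex_zero])

/-- The coordinates of the projections of a point share their label and time, and their vertices
are coherent. -/
theorem exists_edgePoint_eq (p : Continuum) : ∃ x s t, edgePoint x s t = p := by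
  have h : ∀ k, (p.1 k).coord =
      (Vertex.map (G_succ_le k) (p.1 (k + 1)).coord.1, (p.1 (k + 1)).coord.2) := fun k => by
    rw [← SchreierGraph.coord_map]
    exact congrArg SchreierGraph.coord (p.2 k).symm
  have h2 : ∀ k, (p.1 k).coord.2 = (p.1 0).coord.2 := by
    intro k
    induction k with
    | zero => rfl
    | succ k ih => rw [← ih, h k]
  obtain ⟨x, hx⟩ := Seq.exists_vertex_eq (fun k => (p.1 k).coord.1) fun k =>
    (congrArg Prod.fst (h k)).symm
  refine ⟨x, (p.1 0).coord.2.1, (p.1 0).coord.2.2, Subtype.ext (funext fun k => ?_)⟩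
  change SchreierGraph.edge (x.vertex k) _ _ = p.1 k
  rw [hx k, ← h2 k]
  exact SchreierGraph.edge_coord _

/-- The points of the continuum at distance less than `1 / 2` from the vertex `x` on the edges at
this vertex. -/
def vertexNhd (x : Seq) : Set Continuum :=
  {p | p.1 0 ∈ SchreierGraph.halfStar univ ∧ ∀ k, p.1 k ∈ SchreierGraph.halfStar {x.vertex k}}

/-- The interior of the edge labelled `s` that starts at the vertex `x`. -/
def edgeInterior (x : Seq) (s : Fin 2) : Set Continuum :=
  {p | p.1 0 ∈ SchreierGraph.openEdge univ ∧
    ∀ k, p.1 k ∈ SchreierGraph.openEdge {(x.vertex k, s)}}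

theorem isOpen_vertexNhd (x : Seq) : IsOpen[leafTopology Continuum] (vertexNhd x) := by
  have h := isOpen_leafTopology_of_clopen
    (O := {p : Continuum | p.1 0 ∈ SchreierGraph.halfStar univ})
    (Z := fun k => {p : Continuum | p.1 k ∈ SchreierGraph.halfStar {x.vertex k}})
    (Z' := fun k => {p : Continuum | p.1 k ∈ SchreierGraph.halfStar {x.vertex k}ᶜ})
    ((SchreierGraph.isOpen_halfStar _).preimage (continuous_proj 0))
    (fun k => (SchreierGraph.isOpen_halfStar _).preimage (continuous_proj k))
    (fun k => (SchreierGraph.isOpen_halfStar _).preimage (continuous_proj k))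
    (fun k => disjoint_left.2 ?_) (fun k p => ?_)
  · convert h using 1
    ext p
    simp [vertexNhd]
  · intro p hp hp'
    obtain ⟨y, s, t, rfl⟩ := exists_edgePoint_eq p
    have hp := SchreierGraph.edge_mem_halfStar.1 hp
    have hp' := SchreierGraph.edge_mem_halfStar.1 hp'
    rcases hp with ⟨h1, h2⟩ | ⟨h1, h2⟩ <;> rcases hp' with ⟨h1', h2'⟩ | ⟨h1', h2'⟩
    · exact h2' h2
    · linarith
    · linarith
    · exact h2' h2
  · obtain ⟨y, s, t, rfl⟩ := exists_edgePoint_eq p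
    intro hp
    change SchreierGraph.edge (y.vertex k) s t ∈ SchreierGraph.halfStar {x.vertex k} ∨
      SchreierGraph.edge (y.vertex k) s t ∈ SchreierGraph.halfStar {x.vertex k}ᶜ
    simp only [SchreierGraph.edge_mem_halfStar]
    rcases SchreierGraph.edge_mem_halfStar.1 hp with ⟨h1, -⟩ | ⟨h1, -⟩
    · rcases em (y.vertex k ∈ ({x.vertex k} : Set _)) with h | h
      · exact Or.inl (Or.inl ⟨h1, h⟩)
      · exact Or.inr (Or.inl ⟨h1, h⟩)
    · rcases em ((y.vertex k).step s ∈ ({x.vertex k} : Set _)) with h | h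
      · exact Or.inl (Or.inr ⟨h1, h⟩)
      · exact Or.inr (Or.inr ⟨h1, h⟩)

theorem edgePoint_mem_vertexNhd {x y : Seq} {s : Fin 2} {t : unitInterval} :
    edgePoint y s t ∈ vertexNhd x ↔
      ((t : ℝ) < 1 / 2 ∧ y = x) ∨ (1 / 2 < (t : ℝ) ∧ y.step s = x) := by
  change (SchreierGraph.edge _ _ _ ∈ _ ∧ ∀ k, SchreierGraph.edge _ _ _ ∈ _) ↔ _
  simp only [SchreierGraph.edge_mem_halfStar, mem_univ, and_true, mem_singleton_iff,
    Seq.step_vertex]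
  constructor
  · rintro ⟨h | h, h'⟩
    · exact Or.inl ⟨h, Seq.vertex_injective fun k => (h' k).elim (fun h => h.2)
        fun h' => absurd h'.1 (by linarith)⟩
    · exact Or.inr ⟨h, Seq.vertex_injective fun k => (h' k).elim
        (fun h' => absurd h'.1 (by linarith)) fun h => h.2⟩
  · rintro (⟨h, rfl⟩ | ⟨h, rfl⟩)
    · exact ⟨Or.inl h, fun k => Or.inl ⟨h, rfl⟩⟩
    · exact ⟨Or.inr h, fun k => Or.inr ⟨h, rfl⟩⟩

theorem isOpen_edgeInterior (x : Seq) (s : Fin 2) :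
    IsOpen[leafTopology Continuum] (edgeInterior x s) := by
  have h := isOpen_leafTopology_of_clopen
    (O := {p : Continuum | p.1 0 ∈ SchreierGraph.openEdge univ})
    (Z := fun k => {p : Continuum | p.1 k ∈ SchreierGraph.openEdge {(x.vertex k, s)}})
    (Z' := fun k => {p : Continuum | p.1 k ∈ SchreierGraph.openEdge {(x.vertex k, s)}ᶜ})
    ((SchreierGraph.isOpen_openEdge _).preimage (continuous_proj 0))
    (fun k => (SchreierGraph.isOpen_openEdge _).preimage (continuous_proj k))
    (fun k => (SchreierGraph.isOpen_openEdge _).preimage (continuous_proj k))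
    (fun k => disjoint_left.2 ?_) (fun k p => ?_)
  · convert h using 1
    ext p
    simp [edgeInterior]
  · intro p hp hp'
    obtain ⟨y, r, t, rfl⟩ := exists_edgePoint_eq p
    exact (SchreierGraph.edge_mem_openEdge.1 hp').2 (SchreierGraph.edge_mem_openEdge.1 hp).2
  · obtain ⟨y, r, t, rfl⟩ := exists_edgePoint_eq p
    intro hp
    have hp := (SchreierGraph.edge_mem_openEdge.1 hp).1
    exact (em ((y.vertex k, r) ∈ ({(x.vertex k, s)} : Set _))).imp (fun h => ⟨hp, h⟩)
      fun h => ⟨hp, h⟩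

theorem edgePoint_mem_edgeInterior {x y : Seq} {s r : Fin 2} {t : unitInterval} :
    edgePoint y r t ∈ edgeInterior x s ↔
      (0 < t ∧ t < 1) ∧ y = x ∧ r = s := by
  change (SchreierGraph.edge _ _ _ ∈ _ ∧ ∀ k, SchreierGraph.edge _ _ _ ∈ _) ↔ _
  simp only [SchreierGraph.edge_mem_openEdge, mem_univ, and_true, mem_singleton_iff,
    Prod.mk.injEq]
  constructor
  · rintro ⟨h, h'⟩
    exact ⟨h, Seq.vertex_injective fun k => (h' k).2.1, (h' 0).2.2⟩
  · rintro ⟨h, rfl, rfl⟩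
    exact ⟨h, fun k => ⟨h, rfl, rfl⟩⟩

/-- The open star of a set of vertices in the continuum: these vertices with all the open edges
that start or end there. -/
def openStar (A : Set Seq) : Set Continuum :=
  (⋃ x ∈ A, vertexNhd x) ∪
    ⋃ (x : Seq) (s : Fin 2) (_ : x ∈ A ∨ x.step s ∈ A),
      edgeInterior x s

theorem isOpen_openStar (A : Set Seq) : IsOpen[leafTopology Continuum] (openStar A) := by
  let _ := leafTopology Continuum
  exact (isOpen_biUnion fun x _ => isOpen_vertexNhd x).union
    (isOpen_iUnion fun x => isOpen_iUnion fun s => isOpen_iUnion fun _ => isOpen_edgeInterior x s)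

/-- The criterion holds for each of the ways to write a point as a point on an edge. -/
theorem edgePoint_mem_openStar {A : Set Seq} {x : Seq} {s : Fin 2} {t : unitInterval} :
    edgePoint x s t ∈ openStar A ↔ (t < 1 ∧ x ∈ A) ∨ (0 < t ∧ x.step s ∈ A) := by
  simp only [openStar, mem_union, mem_iUnion, edgePoint_mem_vertexNhd, edgePoint_mem_edgeInterior]
  have h0 : 0 < t ↔ 0 < (t : ℝ) := Iff.rfl
  have h1 : t < 1 ↔ (t : ℝ) < 1 := Iff.rfl
  constructor
  · rintro (⟨y, hy, ⟨h, rfl⟩ | ⟨h, rfl⟩⟩ | ⟨y, r, hy, h, rfl, rfl⟩)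
    · exact Or.inl ⟨h1.2 (by linarith), hy⟩
    · exact Or.inr ⟨h0.2 (by linarith), hy⟩
    · exact hy.imp (fun hy => ⟨h.2, hy⟩) fun hy => ⟨h.1, hy⟩
  · have h2 : (0 < t ∧ t < 1) ∨ t = 0 ∨ t = 1 := by
      rcases unitInterval.nonneg'.eq_or_lt with h | h
      · exact Or.inr (Or.inl h.symm)
      · rcases (unitInterval.le_one' (t := t)).eq_or_lt with h' | h'
        · exact Or.inr (Or.inr h')
        · exact Or.inl ⟨h, h'⟩
    rintro (⟨h, hx⟩ | ⟨h, hx⟩)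
    · rcases h2 with h | rfl | rfl
      · exact Or.inr ⟨x, s, Or.inl hx, h, rfl, rfl⟩
      · exact Or.inl ⟨x, hx, Or.inl ⟨by norm_num, rfl⟩⟩
      · exact absurd h (lt_irrefl _)
    · rcases h2 with h | rfl | rfl
      · exact Or.inr ⟨x, s, Or.inr hx, h, rfl, rfl⟩
      · exact absurd h (lt_irrefl _)
      · exact Or.inl ⟨_, hx, Or.inr ⟨by norm_num, rfl⟩⟩

/-! ### The leaf of the identity -/

instance : LocallyPathConnectedSpace unitInterval :=
  (convex_Icc (0 : ℝ) 1).locallyPathConnectedSpace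

instance : PathConnectedSpace unitInterval :=
  isPathConnected_iff_pathConnectedSpace.1 ((convex_Icc (0 : ℝ) 1).isPathConnected ⟨0, by simp⟩)

theorem edgePoint_mem_openStar_leafSeq {x : Seq} {s : Fin 2} {t : unitInterval} :
    edgePoint x s t ∈ openStar leafSeq ↔ x ∈ leafSeq := by
  rw [edgePoint_mem_openStar, step_mem_leafSeq, ← or_and_right, and_iff_right]
  exact (lt_or_ge t 1).imp_right fun h => zero_lt_one.trans_le h

theorem compl_openStar_leafSeq : (openStar leafSeq)ᶜ = openStar leafSeqᶜ := by
  ext p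
  obtain ⟨x, s, t, rfl⟩ := exists_edgePoint_eq p
  rw [mem_compl_iff, edgePoint_mem_openStar_leafSeq, edgePoint_mem_openStar, mem_compl_iff,
    mem_compl_iff, step_mem_leafSeq, ← or_and_right, and_iff_right]
  exact (lt_or_ge t 1).imp_right fun h => zero_lt_one.trans_le h

theorem joined_edgePoint (x : Seq) (s : Fin 2) (t t' : unitInterval) :
    Joined (edgePoint x s t) (edgePoint x s t') := by
  obtain ⟨γ⟩ := PathConnectedSpace.joined t t'
  exact ⟨γ.map (continuous_edgePoint x s)⟩

theorem zero_mem_ball (n : ℕ) : Seq.zero ∈ ball n := ⟨none, fun _ _ => rfl⟩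

/-- The leaf of the identity is the graph spanned by the eventually constant sequences. -/
theorem pathComponent_idPoint : pathComponent idPoint = openStar leafSeq := by
  have h0 : Seq.zero ∈ leafSeq := mem_iUnion_of_mem 0 (zero_mem_ball 0)
  refine Subset.antisymm ?_ fun p hp => ?_
  · rintro p ⟨γ⟩
    have hγ := continuous_leafTopology γ.continuous
    have h1 : IsOpen (γ ⁻¹' openStar leafSeq) :=
      @Continuous.isOpen_preimage _ _ _ (leafTopology Continuum) _ hγ _ (isOpen_openStar _)
    have h2 : IsOpen (γ ⁻¹' openStar leafSeq)ᶜ := by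
      rw [← preimage_compl, compl_openStar_leafSeq]
      exact @Continuous.isOpen_preimage _ _ _ (leafTopology Continuum) _ hγ _ (isOpen_openStar _)
    have h3 : γ ⁻¹' openStar leafSeq = univ := IsClopen.eq_univ ⟨⟨h2⟩, h1⟩ ⟨0, by
      rw [mem_preimage, γ.source, idPoint_eq 0, edgePoint_mem_openStar_leafSeq]; exact h0⟩
    have h4 : (1 : unitInterval) ∈ γ ⁻¹' openStar leafSeq := h3 ▸ mem_univ _
    rwa [mem_preimage, γ.target] at h4
  · obtain ⟨x, s, t, rfl⟩ := exists_edgePoint_eq p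
    have hx := edgePoint_mem_openStar_leafSeq.1 hp
    have h : Joined idPoint (edgePoint x s 0) := by
      rw [edgePoint_zero x s 0]
      refine stepConnected_leafSeq {x | Joined idPoint (edgePoint x 0 0)} ?_ _ h0 x hx ?_
      · intro y _ r _
        have h1 : Joined (edgePoint y 0 0) (edgePoint (y.step r) 0 0) := by
          rw [edgePoint_zero y 0 r, ← edgePoint_one]
          exact joined_edgePoint _ _ _ _
        exact ⟨fun h => h.trans h1, fun h => h.trans h1.symm⟩
      · rw [mem_ofPred_eq, ← idPoint_eq]
    exact h.trans (joined_edgePoint _ _ _ _)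

/-- The point at time `t` of an edge of the leaf. -/
def leafEdge (x : leafSeq) (s : Fin 2) (t : unitInterval) : Leaf idPoint :=
  ⟨edgePoint x s t, pathComponent_idPoint ▸ edgePoint_mem_openStar_leafSeq.2 x.2⟩

theorem exists_leafEdge_eq (p : Leaf idPoint) : ∃ x s t, leafEdge x s t = p := by
  obtain ⟨x, s, t, h⟩ := exists_edgePoint_eq p.1
  have hx : x ∈ leafSeq := by
    rw [← edgePoint_mem_openStar_leafSeq (s := s) (t := t), h, ← pathComponent_idPoint]
    exact p.2
  exact ⟨⟨x, hx⟩, s, t, Subtype.ext h⟩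

theorem continuous_leafEdge (x : leafSeq) (s : Fin 2) : Continuous (leafEdge x s) :=
  continuous_induced_rng.2 (continuous_leafTopology (continuous_edgePoint x s))

/-- The open star of a set of vertices in the leaf. -/
def leafStar (A : Set Seq) : Set (Leaf idPoint) := Subtype.val ⁻¹' openStar A

theorem isOpen_leafStar (A : Set Seq) : IsOpen (leafStar A) :=
  ⟨openStar A, isOpen_openStar A, rfl⟩

theorem leafEdge_mem_leafStar {A : Set Seq} {x : leafSeq} {s : Fin 2} {t : unitInterval} :
    leafEdge x s t ∈ leafStar A ↔ (t < 1 ∧ x.1 ∈ A) ∨ (0 < t ∧ x.1.step s ∈ A) :=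
  edgePoint_mem_openStar

theorem leafEdge_zero (x : leafSeq) (s r : Fin 2) : leafEdge x s 0 = leafEdge x r 0 :=
  Subtype.ext (edgePoint_zero x s r)

theorem leafEdge_one (x : leafSeq) (s r : Fin 2) :
    leafEdge x s 1 = leafEdge ⟨x.1.step s, step_mem_leafSeq.2 x.2⟩ r 0 :=
  Subtype.ext (edgePoint_one x s r)

theorem isConnected_leafStar {A : Set Seq} (hA : StepConnected A) (hne : A.Nonempty)
    (hsub : A ⊆ leafSeq) : IsConnected (leafStar A) := by
  obtain ⟨x, hx⟩ := hne
  -- A segment of an edge joins its end points within the star whenever it is contained in it.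
  have hseg : ∀ (y : leafSeq) (s : Fin 2) (I : Set unitInterval), I.OrdConnected →
      (∀ t ∈ I, leafEdge y s t ∈ leafStar A) → ∀ t ∈ I, ∀ t' ∈ I,
        leafEdge y s t' ∈ connectedComponentIn (leafStar A) (leafEdge y s t) := by
    intro y s I hI h t ht t' ht'
    have hsub : leafEdge y s '' I ⊆ leafStar A := by
      rintro _ ⟨r, hr, rfl⟩
      exact h r hr
    exact (hI.isPreconnected.image _ (continuous_leafEdge y s).continuousOn
      ).subset_connectedComponentIn (mem_image_of_mem _ ht) hsub (mem_image_of_mem _ ht')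
  have hx0 : leafEdge ⟨x, hsub hx⟩ 0 0 ∈ leafStar A :=
    leafEdge_mem_leafStar.2 (Or.inl ⟨zero_lt_one, hx⟩)
  set p := leafEdge ⟨x, hsub hx⟩ 0 0
  have hvert : ∀ y (hy : y ∈ A),
      leafEdge ⟨y, hsub hy⟩ 0 0 ∈ connectedComponentIn (leafStar A) p := by
    intro y hy
    have hT : ∀ z ∈ A, ∀ s : Fin 2, z.step s ∈ A →
        (z ∈ {y | ∃ h : y ∈ leafSeq,
          leafEdge ⟨y, h⟩ 0 0 ∈ connectedComponentIn (leafStar A) p} ↔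
        z.step s ∈ {y | ∃ h : y ∈ leafSeq,
          leafEdge ⟨y, h⟩ 0 0 ∈ connectedComponentIn (leafStar A) p}) := by
      intro z hz s hzs
      have h1 := hseg ⟨z, hsub hz⟩ s univ ordConnected_univ (fun t _ => by
        rw [leafEdge_mem_leafStar]
        exact (lt_or_ge t 1).imp (fun h => ⟨h, hz⟩) fun h => ⟨zero_lt_one.trans_le h, hzs⟩)
        0 (mem_univ _) 1 (mem_univ _)
      rw [leafEdge_one _ s 0, leafEdge_zero _ s 0] at h1
      have h2 := connectedComponentIn_eq h1
      constructor
      · rintro ⟨h, h'⟩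
        exact ⟨hsub hzs, by rw [connectedComponentIn_eq h']; exact h1⟩
      · rintro ⟨h, h'⟩
        refine ⟨hsub hz, ?_⟩
        rw [connectedComponentIn_eq h', ← h2]
        exact mem_connectedComponentIn
          (leafEdge_mem_leafStar.2 (Or.inl ⟨zero_lt_one, hz⟩))
    exact (hA _ hT x hx y hy ⟨hsub hx, mem_connectedComponentIn hx0⟩).2
  have heq : leafStar A = connectedComponentIn (leafStar A) p := by
    refine Subset.antisymm (fun q hq => ?_) (connectedComponentIn_subset _ _)
    obtain ⟨y, s, t, rfl⟩ := exists_leafEdge_eq q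
    rcases leafEdge_mem_leafStar.1 hq with ⟨ht, hy⟩ | ⟨ht, hy⟩
    · have h1 := hseg y s (Iio 1) ordConnected_Iio
        (fun t ht => leafEdge_mem_leafStar.2 (Or.inl ⟨ht, hy⟩)) 0 (mem_Iio.2 zero_lt_one) t ht
      rw [leafEdge_zero y s 0] at h1
      rwa [connectedComponentIn_eq (hvert y hy)]
    · have h1 := hseg y s (Ioi 0) ordConnected_Ioi
        (fun t ht => leafEdge_mem_leafStar.2 (Or.inr ⟨ht, hy⟩)) 1 (mem_Ioi.2 zero_lt_one) t ht
      rw [leafEdge_one y s 0] at h1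
      rwa [connectedComponentIn_eq (hvert _ hy)]
  rw [heq]
  exact isConnected_connectedComponentIn_iff.2 hx0

theorem disjoint_leafStar_arm {n : ℕ} {j j' : Fin 2 × Bool} (hj : j ≠ j') :
    Disjoint (leafStar (arm n j)) (leafStar (arm n j')) := by
  have h0 : ∀ {j}, arm n j ⊆ arm 0 j := fun {j} => arm_antitone j (Nat.zero_le n)
  refine disjoint_left.2 fun p hp hp' => hj ?_
  obtain ⟨x, s, t, rfl⟩ := exists_leafEdge_eq p
  rcases leafEdge_mem_leafStar.1 hp with ⟨-, h⟩ | ⟨-, h⟩ <;>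
    rcases leafEdge_mem_leafStar.1 hp' with ⟨-, h'⟩ | ⟨-, h'⟩
  · exact arm_zero_unique (h0 h) (h0 h')
  · exact arm_eq_of_step (h0 h) (h0 h')
  · exact (arm_eq_of_step (h0 h') (h0 h)).symm
  · exact arm_zero_unique (h0 h) (h0 h')

theorem leafStar_mono {A B : Set Seq} (h : A ⊆ B) : leafStar A ⊆ leafStar B := by
  intro p hp
  obtain ⟨x, s, t, rfl⟩ := exists_leafEdge_eq p
  rw [leafEdge_mem_leafStar] at hp ⊢
  exact hp.imp (fun hp => ⟨hp.1, h hp.2⟩) fun hp => ⟨hp.1, h hp.2⟩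

/-- The complement of the arms is covered by the finitely many edges that start in `ball n`. -/
theorem isCompact_compl_leafStar_arm (n : ℕ) : IsCompact (⋃ j, leafStar (arm n j))ᶜ := by
  have hfin : {x : leafSeq | x.1 ∈ ball n}.Finite :=
    (finite_ball n).preimage Subtype.val_injective.injOn
  have hcpt : IsCompact (⋃ x ∈ {x : leafSeq | x.1 ∈ ball n}, ⋃ s, range (leafEdge x s)) :=
    hfin.isCompact_biUnion fun x _ => isCompact_iUnion fun s =>
      isCompact_range (continuous_leafEdge x s)
  refine hcpt.of_isClosed_subset
    (isOpen_iUnion fun j => isOpen_leafStar (arm n j)).isClosed_compl fun p hp => ?_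
  have hball : ∀ x s t, leafEdge x s t ∈ (⋃ j, leafStar (arm n j))ᶜ → t < 1 → x.1 ∈ ball n := by
    intro x s t h ht
    refine (mem_ball_or_arm x.2).resolve_right ?_
    rintro ⟨j, hj⟩
    exact h (mem_iUnion_of_mem j (leafEdge_mem_leafStar.2 (Or.inl ⟨ht, hj⟩)))
  obtain ⟨x, s, t, rfl⟩ := exists_leafEdge_eq p
  rcases (unitInterval.le_one' (t := t)).eq_or_lt with rfl | ht
  · rw [leafEdge_one x s 0] at hp ⊢
    exact mem_biUnion (hball _ _ _ hp zero_lt_one) (mem_iUnion_of_mem 0 (mem_range_self _))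
  · exact mem_biUnion (hball _ _ _ hp ht) (mem_iUnion_of_mem s (mem_range_self _))

theorem exists_compl_leafStar_arm_mem_nhds (p : Leaf idPoint) :
    ∃ n, (⋃ j, leafStar (arm n j))ᶜ ∈ 𝓝 p := by
  -- The open star of a single vertex `y` avoids the arms as soon as `y` and its four neighbours
  -- lie in the ball.
  have key : ∀ y ∈ leafSeq, ∃ n, leafStar {y} ⊆ (⋃ j, leafStar (arm n j))ᶜ := by
    intro y hy
    have hb : ∀ z ∈ leafSeq, ∃ m, z ∈ ball m := fun z hz => mem_iUnion.1 hz
    obtain ⟨m, hm⟩ := hb y hy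
    choose m₁ h₁ using fun s : Fin 2 => hb (y.step s) (step_mem_leafSeq.2 hy)
    have hr : ∀ s, (y.stepInv s).step s = y := fun s => (Seq.stepEquiv s).apply_symm_apply y
    choose m₂ h₂ using fun s : Fin 2 =>
      hb (y.stepInv s) ((step_mem_leafSeq (s := s)).1 ((hr s).symm ▸ hy))
    obtain ⟨M₁, hM₁⟩ := (finite_range m₁).bddAbove
    obtain ⟨M₂, hM₂⟩ := (finite_range m₂).bddAbove
    set N := max m (max M₁ M₂)
    have hN : ∀ {z k}, z ∈ ball k → k ≤ N → ∀ j, z ∉ arm N j := fun h hk j hj =>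
      notMem_ball_of_mem_arm hj (ball_mono hk h)
    have hy' := hN hm (le_max_left _ _)
    have h₁' : ∀ s j, y.step s ∉ arm N j := fun s => hN (h₁ s)
      ((hM₁ (mem_range_self s)).trans ((le_max_left _ _).trans (le_max_right _ _)))
    have h₂' : ∀ s j, y.stepInv s ∉ arm N j := fun s => hN (h₂ s)
      ((hM₂ (mem_range_self s)).trans ((le_max_right _ _).trans (le_max_right _ _)))
    refine ⟨N, fun q hq hq' => ?_⟩
    obtain ⟨j, hj⟩ := mem_iUnion.1 hq'
    obtain ⟨x, s, t, rfl⟩ := exists_leafEdge_eq q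
    rw [leafEdge_mem_leafStar] at hq hj
    rcases hq with ⟨-, hx⟩ | ⟨-, hx⟩
    · rw [mem_singleton_iff] at hx
      rw [hx] at hj
      exact hj.elim (fun h => hy' j h.2) fun h => h₁' s j h.2
    · rw [mem_singleton_iff] at hx
      have hx' : x.1 = y.stepInv s := by
        rw [← hx]; exact ((Seq.stepEquiv s).symm_apply_apply x.1).symm
      rw [hx] at hj
      exact hj.elim (fun h => h₂' s j (hx' ▸ h.2)) fun h => hy' j h.2
  obtain ⟨x, s, t, rfl⟩ := exists_leafEdge_eq p
  rcases (unitInterval.le_one' (t := t)).eq_or_lt with rfl | ht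
  · obtain ⟨n, hn⟩ := key _ (step_mem_leafSeq (s := s).2 x.2)
    exact ⟨n, Filter.mem_of_superset ((isOpen_leafStar {_}).mem_nhds
      (leafEdge_mem_leafStar.2 (Or.inr ⟨zero_lt_one, rfl⟩))) hn⟩
  · obtain ⟨n, hn⟩ := key _ x.2
    exact ⟨n, Filter.mem_of_superset ((isOpen_leafStar {_}).mem_nhds
      (leafEdge_mem_leafStar.2 (Or.inl ⟨ht, rfl⟩))) hn⟩

end Schori

theorem proposition3p1 : Schori.HasExactlyEnds (Schori.Leaf Schori.idPoint) 4 := by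
  have h := Schori.hasExactlyEnds_of_arms (fun n j => Schori.leafStar (Schori.arm n j))
    (fun n j => Schori.isOpen_leafStar _)
    (fun n j => Schori.isConnected_leafStar (Schori.stepConnected_arm n j)
      (Schori.arm_nonempty n j) (Schori.arm_subset_leafSeq n j))
    (fun n j j' hj => Schori.disjoint_leafStar_arm hj)
    (fun j m n hmn => Schori.leafStar_mono (Schori.arm_antitone j hmn))
    Schori.isCompact_compl_leafStar_arm Schori.exists_compl_leafStar_arm_mem_nhds
  simpa using h
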